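/- Let $k$ be a field of characteristic $\neq 2$; all quadratic forms are finite-dimensional and nondegenerate. Let $V$ be a non-empty set of non-trivial discrete (rank one) valuations on $k$; for $v\in V$ let $k_v$ be the $v$-adic completion of $k$, and for a quadratic form $q$ over $k$ let $q_v$ be $q$ considered over $k_v$. Assume that the local-global principle for isometry holds with respect to $V$: any two quadratic forms over $k$ that become isometric over $k_v$ for all $v\in V$ are isometric over $k$. Let $W(k)$ be the Witt ring of $k$, let $I(k)\subseteq W(k)$ be the ideal of classes of even-dimensional forms, and let $I^n(k)$ be its $n$-th power. Let $n\ge 1$, let $r\ge 0$ be an integer, and let $q$ be an $I^n$-neighbor of complementary dimension $r$, that is, a quadratic form over $k$ with $r<\dim q$ for which there is an $r$-dimensional quadratic form $\sigma_r$ over $k$ such that the Witt class of $q\perp\sigma_r$ belongs to $I^n(k)$. Then $\dim q+r$ is even, and $q$ satisfies $$\mathrm{LGP}\left(\frac{\dim q+r-2^n}{2}+1,\ \frac{\dim q-r}{2}\right)$$ with respect to $V$: if the Witt indices satisfy $i_W(q_v)\ge \frac{\dim q+r-2^n}{2}+1$ for all $v\in V$, then $i_W(q)\ge\frac{\dim q-r}{2}$.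 (If $\dim q+r<2^n$, the first number is $\le 0$ and the condition on the $q_v$ is vacuous, so that $i_W(q)\ge\frac{\dim q-r}{2}$ holds unconditionally.) Here $i_W(\varphi)$ is half of the maximal dimension of a hyperbolic form $m\mathbb H$, $m\ge0$, that is an orthogonal summand of $\varphi$. -/

import Mathlib

open scoped TensorProduct WithZero

universe u

noncomputable section

/-! ### Regular quadratic spaces -/

/-- A (regular, i.e. nondegenerate) finite-dimensional quadratic form over a field `k`. -/
structure RegularForm (k : Type u) [Field k] where
  carrier : Type u
  [addCommGroup : AddCommGroup carrier]
  [module : Module k carrier]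
  [finite : Module.Finite k carrier]
  form : QuadraticForm k carrier
  regular : form.Nondegenerate

namespace RegularForm

attribute [instance] addCommGroup module finite

/-- The dimension of a quadratic form. -/
def dim {k : Type u} [Field k] (q : RegularForm k) : ℕ := Module.finrank k q.carrier

section Constructions

variable {k : Type u} [Field k] [Invertible (2 : k)]

theorem regular_of_equivalent {M N : Type*} [AddCommGroup M] [Module k M] [AddCommGroup N]
    [Module k N] {Q : QuadraticForm k M} {Q' : QuadraticForm k N} (h : Q.Equivalent Q')
    (hQ : Q.Nondegenerate) : Q'.Nondegenerate := by
  rw [QuadraticMap.nondegenerate_iff_radical_eq_bot] at hQ ⊢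
  obtain ⟨e⟩ := h
  rw [← e.map_radical, hQ, Submodule.map_bot]

theorem regular_prod {M N : Type*} [AddCommGroup M] [Module k M] [AddCommGroup N]
    [Module k N] {Q : QuadraticForm k M} {Q' : QuadraticForm k N}
    (hQ : Q.Nondegenerate) (hQ' : Q'.Nondegenerate) :
    QuadraticMap.Nondegenerate (Q := Q.prod Q') := by
  rw [QuadraticMap.nondegenerate_iff_radical_eq_bot] at hQ hQ' ⊢
  rw [Submodule.eq_bot_iff] at hQ hQ' ⊢
  rintro ⟨x, y⟩ hxy
  rw [QuadraticMap.mem_radical_iff'] at hxy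
  obtain ⟨h0, h⟩ := hxy
  have hx : ∀ a, Q (x + a) + Q' y = Q a := fun a => by simpa using h (a, 0)
  have hy : ∀ b, Q x + Q' (y + b) = Q' b := fun b => by simpa using h (0, b)
  have hx2 : ∀ a, Q (x + a) + Q' y = Q a ∧ Q (x + x + a) + Q' y = Q (x + a) := fun a =>
    ⟨hx a, by simpa [add_assoc] using hx (x + a)⟩
  have e1 : Q x + Q' y = 0 := by simpa using h0
  have e2 : Q (x + x) + Q' y = Q x := hx x
  have e3 : Q (x + x) = 4 * Q x := by
    rw [← two_smul k x, QuadraticMap.map_smul, smul_eq_mul]; ring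
  have h2 : (2 : k) ≠ 0 := Invertible.ne_zero 2
  have qx : Q x = 0 := by
    have : (2 : k) * Q x = 0 := by linear_combination e2 - e1 - e3
    exact (mul_eq_zero.mp this).resolve_left h2
  have qy : Q' y = 0 := by simpa [qx] using e1
  refine Prod.ext (hQ x ?_) (hQ' y ?_)
  · rw [QuadraticMap.mem_radical_iff']
    exact ⟨qx, fun a => by simpa [qy] using hx a⟩
  · rw [QuadraticMap.mem_radical_iff']
    exact ⟨qy, fun b => by simpa [qx] using hy b⟩

theorem regular_tmul {M N : Type*} [AddCommGroup M] [Module k M] [AddCommGroup N]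
    [Module k N] [Module.Finite k M] [Module.Finite k N]
    {Q : QuadraticForm k M} {Q' : QuadraticForm k N}
    (hQ : Q.Nondegenerate) (hQ' : Q'.Nondegenerate) :
    QuadraticMap.Nondegenerate (Q := Q.tmul Q') := by
  rw [QuadraticMap.nondegenerate_iff_radical_eq_bot,
    QuadraticMap.radical_eq_ker_associated] at hQ hQ' ⊢
  have key : QuadraticMap.associated (R := k) (Q.tmul Q') =
      (TensorProduct.dualDistrib k M N) ∘ₗ
        TensorProduct.map (QuadraticMap.associated (R := k) Q)
          (QuadraticMap.associated (R := k) Q') := by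
    erw [QuadraticForm.associated_tmul]
    ext a b c d
    simp [mul_comm]
  rw [key, LinearMap.ker_eq_bot]
  rw [LinearMap.ker_eq_bot] at hQ hQ'
  rw [LinearMap.coe_comp]
  refine Function.Injective.comp ?_ ?_
  · exact (TensorProduct.dualDistribEquiv k M N).injective
  · exact TensorProduct.map_injective_of_flat_flat _ _ hQ hQ'

theorem regular_unary (a : kˣ) :
    QuadraticMap.Nondegenerate (Q := ((a : k) • QuadraticMap.sq : QuadraticForm k k)) := by
  rw [QuadraticMap.nondegenerate_iff_radical_eq_bot, Submodule.eq_bot_iff]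
  intro x hx
  simpa using (QuadraticMap.mem_radical_iff'.mp hx).1

theorem regular_of_subsingleton {M : Type*} [AddCommGroup M] [Module k M] [Subsingleton M]
    (Q : QuadraticForm k M) : Q.Nondegenerate := by
  rw [QuadraticMap.nondegenerate_iff_radical_eq_bot]
  exact Subsingleton.elim _ _

/-- The quadratic form `x ↦ a x ^ 2` on the line `k`. -/
def unaryForm (a : kˣ) : QuadraticForm k k := (a : k) • QuadraticMap.sq

/-- The zero-dimensional form. -/
def zero (k : Type u) [Field k] [Invertible (2 : k)] : RegularForm k where
  carrier := PUnit.{u + 1}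
  form := 0
  regular := regular_of_subsingleton _

/-- The one-dimensional form `⟨a⟩ : x ↦ a x ^ 2`. -/
def unary (a : kˣ) : RegularForm k where
  carrier := k
  form := unaryForm a
  regular := regular_unary a

/-- The orthogonal sum `p ⊥ q`. -/
def orthSum (p q : RegularForm k) : RegularForm k where
  carrier := p.carrier × q.carrier
  form := p.form.prod q.form
  regular := regular_prod p.regular q.regular

/-- The tensor product `p ⊗ q`. -/
def tensor (p q : RegularForm k) : RegularForm k where
  carrier := p.carrier ⊗[k] q.carrier
  form := p.form.tmul q.form
  regular := regular_tmul p.regular q.regular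

theorem dim_orthSum (p q : RegularForm k) : (p.orthSum q).dim = p.dim + q.dim :=
  Module.finrank_prod

theorem dim_tensor (p q : RegularForm k) : (p.tensor q).dim = p.dim * q.dim :=
  Module.finrank_tensorProduct

theorem dim_zero : (zero k).dim = 0 :=
  Module.finrank_zero_of_subsingleton (M := PUnit.{u + 1})

end Constructions

/-- Two quadratic forms are isometric. -/
def Isometric {k : Type u} [Field k] (p q : RegularForm k) : Prop :=
  p.form.Equivalent q.form

instance isometrySetoid (k : Type u) [Field k] : Setoid (RegularForm k) where
  r := Isometric
  iseqv := ⟨fun p => QuadraticMap.Equivalent.refl p.form, fun h => h.symm,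
    fun h h' => h.trans h'⟩

end RegularForm

/-! ### The semiring of isometry classes -/

/-- Isometry classes of regular quadratic forms over `k`. -/
def FormClass (k : Type u) [Field k] : Type (u + 1) :=
  Quotient (RegularForm.isometrySetoid k)

namespace FormClass

open RegularForm

/-- The isometry class of a form. -/
def mk {k : Type u} [Field k] (q : RegularForm k) : FormClass k := Quotient.mk _ q

variable {k : Type u} [Field k]

theorem mk_eq_iff {p q : RegularForm k} : mk p = mk q ↔ p.Isometric q :=
  Quotient.eq (r := RegularForm.isometrySetoid k)

theorem exists_rep (x : FormClass k) : ∃ q, x = mk q := by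
  obtain ⟨q, rfl⟩ := Quotient.exists_rep x
  exact ⟨q, rfl⟩

variable [Invertible (2 : k)]

/-- Addition of isometry classes is induced by the orthogonal sum. -/
instance : Add (FormClass k) where
  add := Quotient.map₂ orthSum fun _ _ h _ _ h' => QuadraticMap.Equivalent.prod h h'

/-- Multiplication of isometry classes is induced by the tensor product. -/
instance : Mul (FormClass k) where
  mul := Quotient.map₂ tensor fun p p' h q q' h' => by
    obtain ⟨e⟩ := h
    obtain ⟨e'⟩ := h'
    exact ⟨{ TensorProduct.congr e.toLinearEquiv e'.toLinearEquiv with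
      map_app' := fun x =>
        QuadraticForm.tmul_tensorMap_apply e.toIsometry e'.toIsometry x }⟩

instance : Zero (FormClass k) := ⟨mk (RegularForm.zero k)⟩

instance : One (FormClass k) := ⟨mk (unary 1)⟩

theorem mk_add (p q : RegularForm k) : mk p + mk q = mk (p.orthSum q) := rfl

theorem mk_mul (p q : RegularForm k) : mk p * mk q = mk (p.tensor q) := rfl

theorem mk_zero : mk (RegularForm.zero k) = 0 := rfl

theorem mk_one : mk (unary (1 : kˣ)) = 1 := rfl

theorem add_comm' (x y : FormClass k) : x + y = y + x := by
  obtain ⟨p, rfl⟩ := exists_rep x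
  obtain ⟨q, rfl⟩ := exists_rep y
  exact mk_eq_iff.mpr ⟨QuadraticMap.IsometryEquiv.prodComm _ _⟩

theorem mul_comm' (x y : FormClass k) : x * y = y * x := by
  obtain ⟨p, rfl⟩ := exists_rep x
  obtain ⟨q, rfl⟩ := exists_rep y
  exact mk_eq_iff.mpr ⟨QuadraticForm.tensorComm _ _⟩

theorem add_assoc' (x y z : FormClass k) : x + y + z = x + (y + z) := by
  obtain ⟨p, rfl⟩ := exists_rep x
  obtain ⟨q, rfl⟩ := exists_rep y
  obtain ⟨r, rfl⟩ := exists_rep z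
  exact mk_eq_iff.mpr ⟨{ LinearEquiv.prodAssoc k p.carrier q.carrier r.carrier with
    map_app' := fun x => (add_assoc (p.form x.1.1) (q.form x.1.2) (r.form x.2)).symm }⟩

theorem mul_assoc' (x y z : FormClass k) : x * y * z = x * (y * z) := by
  obtain ⟨p, rfl⟩ := exists_rep x
  obtain ⟨q, rfl⟩ := exists_rep y
  obtain ⟨r, rfl⟩ := exists_rep z
  exact mk_eq_iff.mpr ⟨QuadraticForm.tensorAssoc _ _ _⟩

theorem zero_add' (x : FormClass k) : 0 + x = x := by
  obtain ⟨p, rfl⟩ := exists_rep x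
  exact mk_eq_iff.mpr ⟨{ LinearEquiv.uniqueProd (R := k) (M := p.carrier) (M₂ := PUnit.{u + 1}) with
    map_app' := fun x => (zero_add (p.form x.2)).symm }⟩

theorem one_mul' (x : FormClass k) : 1 * x = x := by
  obtain ⟨p, rfl⟩ := exists_rep x
  have h : unaryForm (1 : kˣ) = QuadraticMap.sq := by
    ext
    simp [unaryForm]
  have e : ((unaryForm (1 : kˣ)).tmul p.form).Equivalent p.form := by
    rw [h]
    exact ⟨QuadraticForm.tensorLId p.form⟩
  exact mk_eq_iff.mpr e

theorem mk_eq_zero_of_subsingleton (p : RegularForm k) (h : Subsingleton p.carrier) :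
    mk p = 0 :=
  mk_eq_iff.mpr ⟨{ (0 : p.carrier ≃ₗ[k] PUnit.{u + 1}) with
    map_app' := fun x => by
      rw [Subsingleton.elim x 0]
      exact (QuadraticMap.map_zero _).trans (QuadraticMap.map_zero _).symm }⟩

theorem zero_mul' (x : FormClass k) : 0 * x = 0 := by
  obtain ⟨p, rfl⟩ := exists_rep x
  exact mk_eq_zero_of_subsingleton _ (inferInstanceAs (Subsingleton (PUnit.{u + 1} ⊗[k] p.carrier)))

theorem mul_add' (x y z : FormClass k) : x * (y + z) = x * y + x * z := by
  obtain ⟨p, rfl⟩ := exists_rep x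
  obtain ⟨q, rfl⟩ := exists_rep y
  obtain ⟨r, rfl⟩ := exists_rep z
  have key : ((p.form.tmul q.form).prod (p.form.tmul r.form)).comp
      (TensorProduct.prodRight k k p.carrier q.carrier r.carrier).toLinearMap =
      p.form.tmul (q.form.prod r.form) := by
    refine (QuadraticMap.associated_rightInverse k).injective ?_
    rw [QuadraticMap.associated_comp]
    erw [QuadraticForm.associated_tmul]
    rw [QuadraticMap.associated_prod, QuadraticMap.associated_prod]
    erw [QuadraticForm.associated_tmul, QuadraticForm.associated_tmul]
    ext <;> simp
  exact mk_eq_iff.mpr ⟨{ TensorProduct.prodRight k k p.carrier q.carrier r.carrier with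
    map_app' := fun x => DFunLike.congr_fun key x }⟩

instance : CommSemiring (FormClass k) where
  add_assoc := add_assoc'
  zero_add := zero_add'
  add_zero x := by rw [add_comm', zero_add']
  add_comm := add_comm'
  nsmul := nsmulRec
  left_distrib := mul_add'
  right_distrib x y z := by rw [mul_comm', mul_add', mul_comm' z x, mul_comm' z y]
  zero_mul := zero_mul'
  mul_zero x := by rw [mul_comm', zero_mul']
  mul_assoc := mul_assoc'
  one_mul := one_mul'
  mul_one x := by rw [mul_comm', one_mul']
  mul_comm := mul_comm'

/-- The class of the hyperbolic plane `ℍ = ⟨1, -1⟩`. -/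
def hyp (k : Type u) [Field k] [Invertible (2 : k)] : FormClass k :=
  mk ((unary 1).orthSum (unary (-1)))

theorem hyp_eq : hyp k = 1 + mk (unary (-1)) := rfl

theorem unary_mul_unary (a b : kˣ) : mk (unary a) * mk (unary b) = mk (unary (a * b)) := by
  have key : (unaryForm (a * b)).comp (TensorProduct.lid k k).toLinearMap =
      (unaryForm a).tmul (unaryForm b) := by
    refine (QuadraticMap.associated_rightInverse k).injective ?_
    rw [QuadraticMap.associated_comp]
    erw [QuadraticForm.associated_tmul]
    ext
    simp [unaryForm, mul_comm]
  exact mk_eq_iff.mpr ⟨{ TensorProduct.lid k k with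
    map_app' := fun x => DFunLike.congr_fun key x }⟩

theorem unary_add_neg (a : kˣ) : mk (unary a) + mk (unary (-a)) = hyp k := by
  have h2 : (2 : k) ≠ 0 := Invertible.ne_zero 2
  have ha : (a : k) ≠ 0 := a.ne_zero
  let f : (k × k) →ₗ[k] (k × k) :=
    { toFun := fun x => ((a * (x.1 - x.2) + (x.1 + x.2)) / 2,
        (a * (x.1 - x.2) - (x.1 + x.2)) / 2)
      map_add' := fun x y => by ext <;> simp <;> ring
      map_smul' := fun c x => by ext <;> simp <;> ring }
  let g : (k × k) →ₗ[k] (k × k) :=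
    { toFun := fun y => (((y.1 + y.2) / a + (y.1 - y.2)) / 2,
        ((y.1 - y.2) - (y.1 + y.2) / a) / 2)
      map_add' := fun x y => by ext <;> simp <;> ring
      map_smul' := fun c x => by ext <;> simp <;> ring }
  have hfg : f ∘ₗ g = LinearMap.id := by
    refine LinearMap.ext fun x => ?_
    ext <;> simp [f, g] <;> field_simp <;> ring
  have hgf : g ∘ₗ f = LinearMap.id := by
    refine LinearMap.ext fun x => ?_
    ext <;> simp [f, g] <;> field_simp <;> ring
  let e : (k × k) ≃ₗ[k] (k × k) := LinearEquiv.ofLinearMap f g hfg hgf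
  have he : ∀ x, ((unaryForm (1 : kˣ)).prod (unaryForm (-1 : kˣ))) (e x) =
      ((unaryForm a).prod (unaryForm (-a))) x := by
    intro x
    simp [e, f, unaryForm]
    field_simp
    ring
  exact mk_eq_iff.mpr ⟨{ e with map_app' := he }⟩

theorem exists_diagonal (n : ℕ) (w : Fin n → kˣ) : ∃ p : RegularForm k,
    (QuadraticMap.weightedSumSquares k w).Equivalent p.form ∧ mk p = ∑ i, mk (unary (w i)) := by
  induction n with
  | zero =>
    refine ⟨RegularForm.zero k, ⟨{ (0 : (Fin 0 → k) ≃ₗ[k] PUnit.{u + 1}) with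
      map_app' := fun x => ?_ }⟩, by simp [mk_zero]⟩
    rw [Subsingleton.elim x 0]
    exact (QuadraticMap.map_zero _).trans (QuadraticMap.map_zero _).symm
  | succ n ih =>
    obtain ⟨p, ⟨e⟩, hp⟩ := ih fun i => w i.succ
    refine ⟨(unary (w 0)).orthSum p, ?_, by rw [← mk_add, hp, Fin.sum_univ_succ]⟩
    let c := (Fin.consLinearEquiv k fun _ : Fin (n + 1) => k).symm
    have hc : ∀ x, ((unaryForm (w 0)).prod
        (QuadraticMap.weightedSumSquares k fun i => w (Fin.succ i))) (c x) =
        QuadraticMap.weightedSumSquares k w x := by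
      intro x
      simp [c, unaryForm, Fin.sum_univ_succ, Units.smul_def, Fin.tail]
    have h1 : (QuadraticMap.weightedSumSquares k w).Equivalent ((unaryForm (w 0)).prod
        (QuadraticMap.weightedSumSquares k fun i => w (Fin.succ i))) :=
      ⟨{ c with map_app' := hc }⟩
    exact h1.trans (QuadraticMap.Equivalent.prod (.refl _) ⟨e⟩)

theorem exists_eq_sum_unary (q : RegularForm k) :
    ∃ w : Fin q.dim → kˣ, mk q = ∑ i, mk (unary (w i)) := by
  have hreg := q.regular
  rw [← QuadraticMap.nondegenerate_associated_iff] at hreg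
  obtain ⟨w, hw⟩ := QuadraticForm.equivalent_weightedSumSquares_units_of_nondegenerate'
    q.form hreg.1
  obtain ⟨p, hp, hsum⟩ := exists_diagonal _ w
  exact ⟨w, (mk_eq_iff.mpr (hw.trans hp)).trans hsum⟩

theorem mul_hyp (q : RegularForm k) : mk q * hyp k = q.dim • hyp k := by
  obtain ⟨w, hw⟩ := exists_eq_sum_unary q
  rw [hw, Finset.sum_mul, Finset.sum_congr rfl (g := fun _ => hyp k)]
  · simp
  · intro i _
    rw [hyp_eq, mul_add, mul_one, unary_mul_unary, mul_neg_one, unary_add_neg, hyp_eq]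

end FormClass

/-! ### The Witt ring and the powers of its fundamental ideal -/

section Witt

variable (k : Type u) [Field k] [Invertible (2 : k)]

/-- Witt equivalence: `x ∼ y` iff `x ⊥ mℍ ≃ y ⊥ nℍ` for some `m` and `n`. It is a congruence
on the semiring of isometry classes. -/
def wittCon : RingCon (FormClass k) where
  r x y := ∃ m n : ℕ, x + m • FormClass.hyp k = y + n • FormClass.hyp k
  iseqv :=
    { refl := fun x => ⟨0, 0, rfl⟩
      symm := fun ⟨m, n, h⟩ => ⟨n, m, h.symm⟩
      trans := by
        rintro x y z ⟨m, n, h⟩ ⟨m', n', h'⟩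
        refine ⟨m + m', n + n', ?_⟩
        rw [add_smul, ← add_assoc, h, add_right_comm, h', add_assoc, ← add_smul, add_comm n'] }
  add' := by
    rintro x y z t ⟨m, n, h⟩ ⟨m', n', h'⟩
    refine ⟨m + m', n + n', ?_⟩
    rw [add_smul, add_smul, add_add_add_comm, h, h', add_add_add_comm]
  mul' := by
    have aux : ∀ x y z : FormClass k, (∃ m n : ℕ,
        x + m • FormClass.hyp k = y + n • FormClass.hyp k) →
        ∃ m n : ℕ, z * x + m • FormClass.hyp k = z * y + n • FormClass.hyp k := by
      rintro x y z ⟨m, n, h⟩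
      obtain ⟨q, rfl⟩ := FormClass.exists_rep z
      refine ⟨m * q.dim, n * q.dim, ?_⟩
      rw [mul_smul, mul_smul, ← FormClass.mul_hyp, ← mul_smul_comm, ← mul_smul_comm,
        ← mul_add, h, mul_add]
    rintro x y z t h h'
    obtain ⟨m, n, e⟩ := aux x y z h
    obtain ⟨m', n', e'⟩ := aux z t y h'
    refine ⟨m + m', n' + n, ?_⟩
    rw [add_smul, ← add_assoc, mul_comm x z, e, mul_comm z y, add_right_comm, e', add_assoc,
      ← add_smul]

/-- The Witt ring `W(k)`: isometry classes of regular forms modulo hyperbolic planes, with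
addition induced by `⊥` and multiplication induced by `⊗`. -/
def WittRing : Type (u + 1) := (wittCon k).Quotient

namespace WittRing

instance : CommSemiring (WittRing k) := inferInstanceAs (CommSemiring (wittCon k).Quotient)

variable {k}

/-- The Witt class of an isometry class. -/
def ofClass : FormClass k →+* WittRing k := (wittCon k).mk'

/-- The Witt class `[q]` of a form `q`. -/
def mk (q : RegularForm k) : WittRing k := ofClass (FormClass.mk q)

theorem exists_rep (x : WittRing k) : ∃ q, x = mk q := by
  obtain ⟨y, rfl⟩ := (wittCon k).mk'_surjective x
  obtain ⟨q, rfl⟩ := FormClass.exists_rep y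
  exact ⟨q, rfl⟩

theorem mk_add (p q : RegularForm k) : mk p + mk q = mk (p.orthSum q) :=
  (map_add ofClass (FormClass.mk p) (FormClass.mk q)).symm

theorem mk_mul (p q : RegularForm k) : mk p * mk q = mk (p.tensor q) :=
  (map_mul ofClass (FormClass.mk p) (FormClass.mk q)).symm

theorem mk_zero : mk (RegularForm.zero k) = 0 := map_zero ofClass

theorem mk_one : mk (RegularForm.unary (1 : kˣ)) = 1 := map_one ofClass

theorem mk_eq_iff {p q : RegularForm k} : mk p = mk q ↔ ∃ m n : ℕ,
    FormClass.mk p + m • FormClass.hyp k = FormClass.mk q + n • FormClass.hyp k :=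
  (wittCon k).eq

theorem ofClass_hyp : ofClass (FormClass.hyp k) = 0 := by
  rw [← map_zero ofClass]
  exact (wittCon k).eq.mpr ⟨0, 1, by simp⟩

/-- Negation in the Witt ring is multiplication by the class of `⟨-1⟩`. -/
instance : Neg (WittRing k) := ⟨fun x => mk (RegularForm.unary (-1)) * x⟩

instance : CommRing (WittRing k) where
  zsmul := zsmulRec
  neg_add_cancel x := by
    change mk (RegularForm.unary (-1)) * x + x = 0
    have h : mk (RegularForm.unary (-1 : kˣ)) + 1 = 0 := by
      rw [add_comm, ← mk_one, mk_add]
      exact ofClass_hyp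
    calc mk (RegularForm.unary (-1)) * x + x
        = (mk (RegularForm.unary (-1 : kˣ)) + 1) * x := by rw [add_mul, one_mul]
      _ = 0 := by rw [h, zero_mul]
  mul_comm := mul_comm

end WittRing

/-- The fundamental ideal `I(k)` of classes of even-dimensional forms in the Witt ring. -/
def fundamentalIdeal : Ideal (WittRing k) where
  carrier := {x | ∃ q : RegularForm k, Even q.dim ∧ x = WittRing.mk q}
  add_mem' := by
    rintro _ _ ⟨p, hp, rfl⟩ ⟨q, hq, rfl⟩
    exact ⟨p.orthSum q, by rw [RegularForm.dim_orthSum]; exact hp.add hq, WittRing.mk_add p q⟩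
  zero_mem' := ⟨RegularForm.zero k, by simp [RegularForm.dim_zero], WittRing.mk_zero.symm⟩
  smul_mem' := by
    rintro c _ ⟨q, hq, rfl⟩
    obtain ⟨p, rfl⟩ := WittRing.exists_rep c
    exact ⟨p.tensor q, by rw [RegularForm.dim_tensor]; exact hq.mul_left _, WittRing.mk_mul p q⟩

end Witt

/-- `q ∈ I^n(k)`: the Witt class of `q` lies in the `n`-th power of the fundamental ideal. -/
def RegularForm.MemIPow {k : Type u} [Field k] [Invertible (2 : k)] (q : RegularForm k)
    (n : ℕ) : Prop :=
  WittRing.mk q ∈ fundamentalIdeal k ^ n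

/-- `q` is an `I^n`-neighbor of complementary dimension `r`: `0 ≤ r < dim q` and there is an
`r`-dimensional form `σ` with `q ⊥ σ ∈ I^n(k)`. -/
def RegularForm.IsINeighbor {k : Type u} [Field k] [Invertible (2 : k)] (q : RegularForm k)
    (n r : ℕ) : Prop :=
  r < q.dim ∧ ∃ σ : RegularForm k, σ.dim = r ∧ (q.orthSum σ).MemIPow n

/-! ### The Witt index and the local-global principles -/

/-- The hyperbolic form `mℍ`, the orthogonal sum of `m` copies of `ℍ = ⟨1, -1⟩`. -/
def hyperbolicForm (K : Type*) [Field K] (m : ℕ) : QuadraticForm K (Fin m → K × K) :=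
  QuadraticMap.pi fun _ => QuadraticMap.prod QuadraticMap.sq (-QuadraticMap.sq)

/-- The Witt index of a form: the largest `m` such that `mℍ` is a subform, i.e. such that the
form is isometric to `mℍ ⊥ ψ` for some form `ψ`. (The set below contains `0` and is bounded by
the dimension.) -/
def wittIndex {K M : Type*} [Field K] [AddCommGroup M] [Module K M] (Q : QuadraticForm K M) : ℕ :=
  sSup {m : ℕ | ∃ (d : ℕ) (ψ : QuadraticForm K (Fin d → K)),
    Q.Equivalent ((hyperbolicForm K m).prod ψ)}

section LocalGlobal

variable {k : Type u} [Field k]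

/-- Multiplication by a fixed element of `k` is uniformly continuous for the `v`-adic uniformity,
so that the completion `k_v` is a `k`-algebra. -/
instance (v : Valuation k ℤᵐ⁰) : UniformContinuousConstSMul k (WithVal v) where
  uniformContinuous_const_smul x :=
    uniformContinuous_const_smul (WithVal.toVal v x : WithVal v)

variable [Invertible (2 : k)]

/-- The form `q_v` over the `v`-adic completion `k_v` of `k`. -/
def RegularForm.atPlace (q : RegularForm k) (v : Valuation k ℤᵐ⁰) :
    QuadraticForm v.Completion (v.Completion ⊗[k] q.carrier) :=
  q.form.baseChange v.Completion

/-- The local-global principle for isometry holds over `k` with respect to `V`. -/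
def LocalGlobalIsometry (V : Set (Valuation k ℤᵐ⁰)) : Prop :=
  ∀ p q : RegularForm k, (∀ v ∈ V, (p.atPlace v).Equivalent (q.atPlace v)) → p.Isometric q

/-- `q` satisfies `LGP(r, s)` with respect to `V`: if `i_W(q_v) ≥ r` for all `v ∈ V`, then
`i_W(q) ≥ s`. -/
def RegularForm.SatisfiesLGP (q : RegularForm k) (V : Set (Valuation k ℤᵐ⁰)) (r s : ℤ) : Prop :=
  (∀ v ∈ V, r ≤ (wittIndex (q.atPlace v) : ℤ)) → s ≤ (wittIndex q.form : ℤ)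

end LocalGlobal

end

/-!
Let `q ⊥ σ` have Witt class in `Iⁿ(k)`. If `i_W(q_v) ≥ (dim q + r - 2ⁿ) / 2 + 1`, then over `k_v`
the form `q ⊥ σ` is Witt equivalent to a form of dimension less than `2ⁿ`, so that it is trivial in
`W(k_v)` by the Hauptsatz of Arason and Pfister (`WittRing.mk_eq_zero_of_mem_pow`). If this holds
for all `v ∈ V`, the local-global principle makes `q ⊥ σ` hyperbolic over `k`, and Witt cancellation
of `σ ⊥ -σ = rℍ` leaves `q ≅ ((dim q - r) / 2) ℍ ⊥ -σ`.

The Hauptsatz is the substantial part. The ideal `Iⁿ` is additively generated by scalar multiples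
of `n`-fold Pfister forms, and an anisotropic form `q` whose class is a sum of `s` of these is shown
to have dimension `0` or at least `2ⁿ` by induction on `s`, for all fields at once
(`WittRing.IsPfisterSum.two_pow_le_dim`). One passes to an extension `L` over which one of the
Pfister forms, `π`, becomes isotropic, hence hyperbolic by roundness
(`RegularForm.witt_pfister_eq_zero`). If `q` does not become hyperbolic over `L`, its anisotropic
part over `L` is bounded below by induction.

The role of `L` is that of the function field of `π`, obtained in two steps
(`RegularForm.exists_extension_pfister`). Let `F = k(x₁, …, x_N)` with `N = 2ⁿ - 1`. For a
diagonalization `⟨w₀, …, w_N⟩` of `π` and `δ = -(w₁ x₁² + ⋯ + w_N x_N²) / w₀`, the vector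
`(√δ, x₁, …, x_N)` is a zero of `π` over `L = F(√δ)`. If `q` becomes hyperbolic over `L`, it is a
multiple of `⟨1, -δ⟩` over `F`, so that `-δ` is a similarity factor of `q` over `F`; thus `q`
represents `-δ b` for some nonzero `b ∈ k`, a generic value of an `N`-dimensional form over `k`.
By the theorem of Cassels and Pfister, applied to one variable at a time
(`Matrix.exists_generic_extension`), this forces `N ≤ dim q`, and `dim q ≥ 2ⁿ` follows as `dim q`
is even.
-/


noncomputable section

/-! ### Reflections and Witt cancellation -/

namespace QuadraticMap

variable {k M : Type*} [Field k] [Invertible (2 : k)] [AddCommGroup M] [Module k M]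

theorem map_add_associated (Q : QuadraticForm k M) (x y : M) :
    Q (x + y) = Q x + Q y + 2 * associated (R := k) Q x y := by
  have h := LinearMap.congr_fun₂ (two_nsmul_associated k Q) x y
  rw [LinearMap.smul_apply, LinearMap.smul_apply, nsmul_eq_mul, polarBilin_apply_apply, polar] at h
  push_cast at h
  linear_combination -h

theorem map_sub_associated (Q : QuadraticForm k M) (x y : M) :
    Q (x - y) = Q x + Q y - 2 * associated (R := k) Q x y := by
  have h := map_add_associated Q x (-y)
  rw [QuadraticMap.map_neg, LinearMap.map_neg] at h
  rw [sub_eq_add_neg, h]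
  ring

theorem associated_comm (Q : QuadraticForm k M) (x y : M) :
    associated (R := k) Q x y = associated (R := k) Q y x := by
  exact associated_isSymm k Q x y

theorem associated_self (Q : QuadraticForm k M) (x : M) :
    associated (R := k) Q x x = Q x :=
  associated_eq_self_apply k Q x

/-- The reflection in the hyperplane orthogonal to an anisotropic vector `w`. -/
def reflectionIsometry (Q : QuadraticForm k M) (w : M) (hw : Q w ≠ 0) : Q.IsometryEquiv Q :=
  let f : M →ₗ[k] M := LinearMap.id - (2 / Q w) • (associated (R := k) Q w).smulRight w
  { LinearEquiv.ofInvolutive f (fun x => by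
      simp only [f, LinearMap.sub_apply, LinearMap.id_apply, LinearMap.smul_apply,
        LinearMap.smulRight_apply, map_sub, map_smul, associated_self]
      match_scalars
      · ring
      · field_simp
        ring) with
    map_app' := fun x => by
      change Q (x - (2 / Q w) • (associated (R := k) Q w x • w)) = Q x
      rw [map_sub_associated, QuadraticMap.map_smul, QuadraticMap.map_smul, LinearMap.map_smul,
        LinearMap.map_smul,
        associated_comm Q x w]
      simp only [smul_eq_mul]
      field_simp
      ring }

theorem reflectionIsometry_apply (Q : QuadraticForm k M) (w : M) (hw : Q w ≠ 0) (x : M) :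
    Q.reflectionIsometry w hw x = x - (2 / Q w) • (associated (R := k) Q w x • w) := rfl

/-- The orthogonal group acts transitively on the vectors of a given non-zero value: one of the
reflections in `x - y` and `x + y` carries `x` to `± y`. -/
theorem exists_isometryEquiv_apply_eq (Q : QuadraticForm k M) {x y : M} (hxy : Q x = Q y)
    (hy : Q y ≠ 0) : ∃ τ : Q.IsometryEquiv Q, τ x = y := by
  have h2 : (2 : k) ≠ 0 := Invertible.ne_zero 2
  have hm := map_sub_associated Q x y
  have hp := map_add_associated Q x y
  by_cases h : Q (x - y) = 0
  · have h' : Q (x + y) ≠ 0 := by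
      intro h'
      have : (2 : k) * 2 * Q y = 0 := by
        linear_combination -(2 : k) * hxy + h + h' - hm - hp
      simp [h2, hy] at this
    let neg : Q.IsometryEquiv Q := { LinearEquiv.neg k with map_app' := fun x => by simp }
    refine ⟨(Q.reflectionIsometry (x + y) h').trans neg, ?_⟩
    change - (Q.reflectionIsometry (x + y) h' x) = y
    have e : 2 / Q (x + y) * associated (R := k) Q (x + y) x = 1 := by
      rw [LinearMap.map_add, LinearMap.add_apply, associated_self, associated_comm Q y x]
      rw [div_mul_eq_mul_div, div_eq_one_iff_eq h', hp, hxy]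
      ring
    rw [reflectionIsometry_apply, smul_smul, e]
    module
  · refine ⟨Q.reflectionIsometry (x - y) h, ?_⟩
    have e : 2 / Q (x - y) * associated (R := k) Q (x - y) x = 1 := by
      rw [LinearMap.map_sub, LinearMap.sub_apply, associated_self, associated_comm Q y x]
      rw [div_mul_eq_mul_div, div_eq_one_iff_eq h, hm, hxy]
      ring
    rw [reflectionIsometry_apply, smul_smul, e]
    module

end QuadraticMap

namespace RegularForm

open QuadraticMap

variable {k : Type u} [Field k] [Invertible (2 : k)]

theorem regular_right_of_prod {M N : Type*} [AddCommGroup M] [Module k M] [AddCommGroup N]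
    [Module k N] {Q : QuadraticForm k M} {Q' : QuadraticForm k N}
    (h : QuadraticMap.Nondegenerate (Q := Q.prod Q')) : Q'.Nondegenerate := by
  rw [QuadraticMap.nondegenerate_iff_radical_eq_bot, Submodule.eq_bot_iff] at h ⊢
  intro x hx
  rw [QuadraticMap.mem_radical_iff'] at hx
  have := h (0, x) (by
    rw [QuadraticMap.mem_radical_iff']
    exact ⟨by simp [hx.1], fun a => by simp [hx.2]⟩)
  simpa using this

/-- A vector of value `a ≠ 0` splits off a summand `⟨a⟩`, and the complement represents the
values of all vectors orthogonal to the given one. -/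
theorem exists_split (q : RegularForm k) (a : kˣ) (v : q.carrier) (hv : q.form v = a) :
    ∃ p : RegularForm k, FormClass.mk q = FormClass.mk (unary a) + FormClass.mk p ∧
      ∀ u, associated (R := k) q.form v u = 0 → ∃ u', p.form u' = q.form u := by
  let B := associated (R := k) q.form
  have ha : (a : k) ≠ 0 := a.ne_zero
  have hB : B v v = a := by rw [← hv]; exact associated_self q.form v
  let f : (k × LinearMap.ker (B v)) →ₗ[k] q.carrier :=
    (LinearMap.toSpanSingleton k _ v).coprod (Submodule.subtype _)
  let g : q.carrier →ₗ[k] (k × LinearMap.ker (B v)) :=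
    ((a : k)⁻¹ • B v).prod
      ((LinearMap.id - ((a : k)⁻¹ • B v).smulRight v).codRestrict _ (fun x => by
        simp only [LinearMap.mem_ker, LinearMap.sub_apply, LinearMap.id_apply,
          LinearMap.smulRight_apply, map_sub, map_smul, LinearMap.smul_apply, smul_eq_mul, hB]
        field_simp
        ring))
  have hfg : f ∘ₗ g = LinearMap.id := by
    refine LinearMap.ext fun x => ?_
    simp [f, g]
  have hgf : g ∘ₗ f = LinearMap.id := by
    refine LinearMap.ext fun x => ?_
    obtain ⟨t, y, hy⟩ := x
    rw [LinearMap.mem_ker] at hy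
    refine Prod.ext ?_ (Subtype.ext ?_)
    · simp [f, g, hB, hy]
      rw [mul_comm t, inv_mul_cancel_left₀ ha]
    · simp [f, g, hB, hy]
  let Q' : QuadraticForm k (LinearMap.ker (B v)) := q.form.comp (Submodule.subtype _)
  have e : q.form.Equivalent ((unaryForm a).prod Q') := by
    let E : (k × LinearMap.ker (B v)) ≃ₗ[k] q.carrier := LinearEquiv.ofLinearMap f g hfg hgf
    refine QuadraticMap.Equivalent.symm ⟨{ E with map_app' := ?_ }⟩
    rintro ⟨t, y, hy⟩
    rw [LinearMap.mem_ker] at hy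
    change q.form (t • v + y) = _
    rw [map_add_associated, QuadraticMap.map_smul, LinearMap.map_smul, LinearMap.smul_apply, hv]
    change _ + 2 * t • B v y = _
    rw [hy]
    simp [unaryForm, Q', mul_comm]
  refine ⟨⟨LinearMap.ker (B v), Q', regular_right_of_prod (regular_of_equivalent e q.regular)⟩,
    FormClass.mk_eq_iff.mpr e, fun u hu => ⟨⟨u, hu⟩, rfl⟩⟩

end RegularForm

namespace FormClass

open RegularForm QuadraticMap

variable {k : Type u} [Field k] [Invertible (2 : k)]

/-- An isometry fixing the vector `(1, 0)` preserves its orthogonal complement, which is given by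
the vanishing of the first coordinate. -/
theorem fst_isometryEquiv_apply_eq_zero {M N : Type*} [AddCommGroup M] [Module k M]
    [AddCommGroup N] [Module k N] {Q : QuadraticForm k M} {Q' : QuadraticForm k N} {a : kˣ}
    (e : ((unaryForm a).prod Q).IsometryEquiv ((unaryForm a).prod Q'))
    (he : e (1, 0) = (1, 0)) (y : M) : (e (0, y)).1 = 0 := by
  have h := e.map_app ((0, y) + (1, 0))
  have h' := e.map_app (0, y)
  have hadd : e ((0, y) + (1, 0)) = e (0, y) + e (1, 0) := map_add e.toLinearEquiv _ _
  rw [hadd, he] at h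
  simp only [prod_apply, unaryForm, Prod.fst_add, Prod.snd_add, add_zero, zero_add,
    _root_.smul_apply, sq_apply, smul_eq_mul] at h h'
  have h4 : (2 : k) * a * (e (0, y)).1 = 0 := by linear_combination h - h'
  simpa [Invertible.ne_zero (2 : k)] using h4

theorem unary_add_cancel {a : kˣ} {p q : RegularForm k}
    (h : mk (unary a) + mk p = mk (unary a) + mk q) : mk p = mk q := by
  obtain ⟨e⟩ := mk_eq_iff.mp h
  let Q : QuadraticForm k (k × q.carrier) := (unaryForm a).prod q.form
  let P : QuadraticForm k (k × p.carrier) := (unaryForm a).prod p.form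
  let e : P.IsometryEquiv Q := e
  have h1 : P (1, 0) = a := by simp [P, unaryForm]
  have h2 : Q (1, 0) = a := by simp [Q, unaryForm]
  obtain ⟨τ, hτ⟩ := Q.exists_isometryEquiv_apply_eq (x := e (1, 0)) (y := (1, 0))
    (by rw [e.map_app, h1, h2]) (by rw [h2]; exact a.ne_zero)
  let e' : P.IsometryEquiv Q := e.trans τ
  have he' : e' (1, 0) = (1, 0) := hτ
  have he'' : e'.symm (1, 0) = (1, 0) := by
    rw [← he']; exact e'.toLinearEquiv.symm_apply_apply _
  have key := fst_isometryEquiv_apply_eq_zero e' he'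
  have key' := fst_isometryEquiv_apply_eq_zero e'.symm he''
  let f : p.carrier →ₗ[k] q.carrier :=
    LinearMap.snd k k _ ∘ₗ e'.toLinearEquiv.toLinearMap ∘ₗ LinearMap.inr k k _
  let g : q.carrier →ₗ[k] p.carrier :=
    LinearMap.snd k k _ ∘ₗ e'.symm.toLinearEquiv.toLinearMap ∘ₗ LinearMap.inr k k _
  have hf : ∀ y, ((0 : k), f y) = e' (0, y) := fun y => Prod.ext (key y).symm rfl
  have hg : ∀ y, ((0 : k), g y) = e'.symm (0, y) := fun y => Prod.ext (key' y).symm rfl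
  have hfg : f ∘ₗ g = LinearMap.id := by
    refine LinearMap.ext fun y => ?_
    have : ((0 : k), f (g y)) = (0, y) := by
      rw [hf, hg]; exact e'.toLinearEquiv.apply_symm_apply _
    exact congrArg Prod.snd this
  have hgf : g ∘ₗ f = LinearMap.id := by
    refine LinearMap.ext fun y => ?_
    have : ((0 : k), g (f y)) = (0, y) := by
      rw [hg, hf]; exact e'.toLinearEquiv.symm_apply_apply _
    exact congrArg Prod.snd this
  let E : p.carrier ≃ₗ[k] q.carrier := LinearEquiv.ofLinearMap f g hfg hgf
  refine mk_eq_iff.mpr ⟨{ E with map_app' := fun y => ?_ }⟩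
  have h5 : Q (0, f y) = P (0, y) := by rw [hf, e'.map_app]
  change q.form (f y) = p.form y
  simpa [Q, P] using h5

theorem induction_unary {P : FormClass k → Prop} (h0 : P 0)
    (h1 : ∀ (a : kˣ) x, P x → P (mk (unary a) + x)) (x : FormClass k) : P x := by
  obtain ⟨q, rfl⟩ := exists_rep x
  obtain ⟨w, hw⟩ := exists_eq_sum_unary q
  rw [hw]
  clear hw
  generalize q.dim = n at w
  induction n with
  | zero => simpa using h0
  | succ n ih => rw [Fin.sum_univ_succ]; exact h1 _ _ (ih fun i => w i.succ)

/-- Witt cancellation. -/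
instance : IsCancelAdd (FormClass k) :=
  haveI : IsLeftCancelAdd (FormClass k) := ⟨fun z => by
    refine induction_unary (P := fun z => ∀ x y : FormClass k, z + x = z + y → x = y) ?_ ?_ z
    · intro x y h
      simpa using h
    · intro a z ih x y h
      obtain ⟨p, hp⟩ := exists_rep (z + x)
      obtain ⟨q, hq⟩ := exists_rep (z + y)
      apply ih
      rw [add_assoc, add_assoc, hp, hq] at h
      rw [hp, hq]
      exact unary_add_cancel h⟩
  AddCommMagma.IsLeftCancelAdd.toIsCancelAdd _

/-- The dimension as an additive function of the isometry class. -/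
def dim : FormClass k →+ ℕ where
  toFun := Quotient.lift RegularForm.dim fun _ _ ⟨e⟩ => e.toLinearEquiv.finrank_eq
  map_zero' := dim_zero
  map_add' x y := by
    obtain ⟨p, rfl⟩ := exists_rep x
    obtain ⟨q, rfl⟩ := exists_rep y
    exact dim_orthSum p q

@[simp] theorem dim_mk (q : RegularForm k) : dim (mk q) = q.dim := rfl

@[simp] theorem dim_unary (a : kˣ) : dim (mk (unary a)) = 1 := Module.finrank_self k

@[simp] theorem dim_hyp : dim (hyp k) = 2 := by
  rw [hyp_eq, ← mk_one, map_add, dim_unary, dim_unary]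

theorem dim_nsmul_hyp (n : ℕ) : dim (n • hyp k) = 2 * n := by
  rw [map_nsmul, dim_hyp, smul_eq_mul, mul_comm]

end FormClass

namespace RegularForm

open QuadraticMap

variable {k : Type u} [Field k] [Invertible (2 : k)]

theorem dim_unary (a : kˣ) : (unary a).dim = 1 := Module.finrank_self k

theorem mk_eq_zero_of_dim {q : RegularForm k} (h : q.dim = 0) : FormClass.mk q = 0 :=
  FormClass.mk_eq_zero_of_subsingleton _ (Module.finrank_zero_iff.mp h)

omit [Invertible (2 : k)] in
theorem Isometric.anisotropic {p q : RegularForm k} (h : p.Isometric q)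
    (hp : p.form.Anisotropic) : q.form.Anisotropic := by
  obtain ⟨e⟩ := h.symm
  intro x hx
  have := hp (e x) (by rw [e.map_app, hx])
  exact e.toLinearEquiv.map_eq_zero_iff.mp this

omit [Invertible (2 : k)] in
theorem Isometric.exists_apply_eq {p q : RegularForm k} (h : p.Isometric q) (x : p.carrier) :
    ∃ y, q.form y = p.form x := by
  obtain ⟨e⟩ := h
  exact ⟨e x, e.map_app x⟩

/-- An isotropic regular form splits off a hyperbolic plane. -/
theorem exists_eq_hyp_add (q : RegularForm k) (hq : ¬ q.form.Anisotropic) :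
    ∃ p : RegularForm k, FormClass.mk q = FormClass.hyp k + FormClass.mk p := by
  obtain ⟨v, hv0, hv⟩ := (QuadraticMap.not_anisotropic_iff_exists _).mp hq
  set B := associated (R := k) q.form with hBdef
  have hreg : B.Nondegenerate := (QuadraticMap.nondegenerate_associated_iff).mpr q.regular
  have h2 : (2 : k) ≠ 0 := Invertible.ne_zero 2
  obtain ⟨w, hw⟩ : ∃ w, B v w ≠ 0 := by
    by_contra! h
    exact hv0 (hreg.1 v h)
  -- The plane spanned by `v` and `w` contains a vector `e` of value `1`.
  let s : k := (1 - q.form w) / (2 * B v w)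
  let e := w + s • v
  have he : q.form e = (1 : kˣ) := by
    change q.form (w + s • v) = _
    rw [map_add_associated, QuadraticMap.map_smul, hv, LinearMap.map_smul, associated_comm]
    change _ + 2 * s • B v w = _
    simp only [s, smul_eq_mul, Units.val_one]
    field_simp
    ring
  have hBe : B e v = B v w := by
    have : B v v = 0 := by rw [hBdef, associated_self, hv]
    simp only [e, map_add, map_smul, LinearMap.add_apply, LinearMap.smul_apply, this, smul_zero,
      add_zero]
    exact associated_comm _ _ _
  obtain ⟨p, hp, hp'⟩ := exists_split q 1 e he
  have hee : B e e = 1 := by rw [hBdef, associated_self, he]; rfl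
  -- The component of `v` orthogonal to `e`, scaled to have value `-1`.
  let f := (B v w)⁻¹ • (v - B v w • e)
  have hf1 : B e f = 0 := by
    simp [f, hee, hBe]
  have hf2 : q.form f = (-1 : kˣ) := by
    change q.form ((B v w)⁻¹ • (v - B v w • e)) = _
    rw [QuadraticMap.map_smul, map_sub_associated, hv, QuadraticMap.map_smul, he,
      LinearMap.map_smul, associated_comm q.form v e, ← hBdef, hBe]
    simp only [smul_eq_mul, Units.val_one, Units.val_neg]
    field_simp
    ring
  obtain ⟨f', hf'⟩ := hp' f hf1
  obtain ⟨r, hr, -⟩ := exists_split p (-1) f' (hf'.trans hf2)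
  exact ⟨r, by rw [hp, hr, ← add_assoc, FormClass.hyp_eq, FormClass.mk_one]⟩

/-- The Witt decomposition. -/
theorem exists_anisotropic (q : RegularForm k) : ∃ (i : ℕ) (p : RegularForm k),
    FormClass.mk q = i • FormClass.hyp k + FormClass.mk p ∧ p.form.Anisotropic := by
  induction h : q.dim using Nat.strong_induction_on generalizing q with
  | _ n ih =>
    by_cases hq : q.form.Anisotropic
    · exact ⟨0, q, by simp, hq⟩
    · obtain ⟨p, hp⟩ := exists_eq_hyp_add q hq
      have hd := congrArg FormClass.dim hp
      simp at hd
      obtain ⟨i, r, hr, hr'⟩ := ih p.dim (by omega) p rfl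
      exact ⟨i + 1, r, by rw [hp, hr, ← add_assoc, add_smul, one_smul, add_comm (FormClass.hyp k)],
        hr'⟩

theorem anisotropic_of_mk_eq_add {p q r : RegularForm k}
    (h : FormClass.mk q = FormClass.mk p + FormClass.mk r) (hq : q.form.Anisotropic) :
    p.form.Anisotropic ∧ r.form.Anisotropic :=
  anisotropic_of_prod (Isometric.anisotropic (FormClass.mk_eq_iff.mp h) hq)

theorem not_anisotropic_hyp_add (p : RegularForm k) {q : RegularForm k}
    (h : FormClass.mk q = FormClass.hyp k + FormClass.mk p) : ¬ q.form.Anisotropic := by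
  intro hq
  have h1 := (anisotropic_of_mk_eq_add (p := (unary 1).orthSum (unary (-1))) h hq).1
    (show k × k from (1, 1)) (by
      change (unaryForm 1).prod (unaryForm (-1)) ((1 : k), (1 : k)) = 0
      simp [unaryForm])
  exact one_ne_zero (α := k) (congrArg Prod.fst h1)

end RegularForm

namespace WittRing

open RegularForm

variable {k : Type u} [Field k] [Invertible (2 : k)]

theorem neg_unary (a : kˣ) : -mk (unary a) = mk (unary (-a)) := by
  refine neg_eq_of_add_eq_zero_right ?_
  change ofClass _ + ofClass _ = 0
  rw [← map_add, FormClass.unary_add_neg, ofClass_hyp]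

theorem unary_mul_unary (a b : kˣ) : mk (unary a) * mk (unary b) = mk (unary (a * b)) := by
  change ofClass _ * ofClass _ = ofClass _
  rw [← map_mul, FormClass.unary_mul_unary]

/-- Forms with the same Witt class and the same dimension are isometric. -/
theorem mk_eq_of_dim_eq {p q : RegularForm k} (h : mk p = mk q) (hd : p.dim = q.dim) :
    FormClass.mk p = FormClass.mk q := by
  obtain ⟨m, n, h⟩ := mk_eq_iff.mp h
  have hd' := congrArg FormClass.dim h
  simp only [map_add, FormClass.dim_mk, FormClass.dim_nsmul_hyp, hd] at hd'
  rw [show m = n by omega] at h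
  exact add_right_cancel h

/-- A form of trivial Witt class is hyperbolic. -/
theorem eq_nsmul_hyp_of_mk_eq_zero {q : RegularForm k} (h : mk q = 0) :
    ∃ m : ℕ, FormClass.mk q = m • FormClass.hyp k := by
  rw [← mk_zero] at h
  obtain ⟨m, n, h⟩ := mk_eq_iff.mp h
  rw [FormClass.mk_zero, zero_add] at h
  have hd := congrArg FormClass.dim h
  simp only [map_add, FormClass.dim_mk, FormClass.dim_nsmul_hyp] at hd
  obtain ⟨d, rfl⟩ : ∃ d, n = d + m := ⟨n - m, by omega⟩
  rw [add_smul] at h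
  exact ⟨d, add_right_cancel h⟩

theorem dim_eq_zero_of_anisotropic {q : RegularForm k} (h : mk q = 0)
    (hq : q.form.Anisotropic) : q.dim = 0 := by
  obtain ⟨m, hm⟩ := eq_nsmul_hyp_of_mk_eq_zero h
  cases m with
  | zero => simpa using congrArg FormClass.dim hm
  | succ m =>
    obtain ⟨p, hp⟩ := FormClass.exists_rep (m • FormClass.hyp k)
    rw [add_smul, one_smul, hp, add_comm] at hm
    exact absurd hq (not_anisotropic_hyp_add p hm)

theorem even_dim_of_mk_eq {p q : RegularForm k} (h : mk p = mk q) (hp : Even p.dim) :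
    Even q.dim := by
  obtain ⟨m, n, h⟩ := mk_eq_iff.mp h
  have hd := congrArg FormClass.dim h
  simp only [map_add, FormClass.dim_mk, FormClass.dim_nsmul_hyp] at hd
  rw [Nat.even_iff] at *
  omega

theorem even_dim_of_mem {q : RegularForm k} (h : mk q ∈ fundamentalIdeal k) : Even q.dim := by
  obtain ⟨p, hp, hpq⟩ := h
  exact even_dim_of_mk_eq hpq.symm hp

theorem exists_anisotropic (q : RegularForm k) :
    ∃ p : RegularForm k, mk p = mk q ∧ p.form.Anisotropic ∧ p.dim ≤ q.dim := by
  obtain ⟨i, p, h, hp⟩ := RegularForm.exists_anisotropic q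
  refine ⟨p, ?_, hp, ?_⟩
  · change ofClass _ = ofClass _
    rw [h, map_add, map_nsmul, ofClass_hyp]
    simp
  · have := congrArg FormClass.dim h
    simp only [map_add, FormClass.dim_mk, FormClass.dim_nsmul_hyp] at this
    omega

end WittRing

/-! ### Extension of the base field -/

namespace RegularForm

open QuadraticMap

section
variable {k : Type u} [Field k] [Invertible (2 : k)]
variable (L : Type u) [Field L] [Algebra k L]

theorem baseChange_equivalent {M N : Type*} [AddCommGroup M] [Module k M] [AddCommGroup N]
    [Module k N] {Q : QuadraticForm k M} {Q' : QuadraticForm k N} (h : Q.Equivalent Q') :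
    (Q.baseChange L).Equivalent (Q'.baseChange L) := by
  obtain ⟨e⟩ := h
  let E : (L ⊗[k] M) ≃ₗ[L] (L ⊗[k] N) := e.toLinearEquiv.baseChange k L M N
  have key : (Q'.baseChange L).comp E.toLinearMap = Q.baseChange L := by
    refine baseChange_ext fun m => ?_
    change Q'.baseChange L (1 ⊗ₜ e m) = _
    simp
  exact ⟨{ E with map_app' := fun x => DFunLike.congr_fun key x }⟩

theorem baseChange_unaryForm (a : kˣ) : ((unaryForm a).baseChange L).Equivalent
    (unaryForm (Units.map (algebraMap k L).toMonoidHom a)) := by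
  let E : (L ⊗[k] k) ≃ₗ[L] L := TensorProduct.AlgebraTensorModule.rid k L L
  have key : (unaryForm (Units.map (algebraMap k L).toMonoidHom a)).comp E.toLinearMap =
      (unaryForm a).baseChange L := by
    refine baseChange_ext fun m => ?_
    rw [QuadraticForm.baseChange_tmul]
    simp [E, unaryForm, Algebra.smul_def]
  exact ⟨{ E with map_app' := fun x => DFunLike.congr_fun key x }⟩

theorem baseChange_prod {M N : Type*} [AddCommGroup M] [Module k M] [AddCommGroup N]
    [Module k N] (Q : QuadraticForm k M) (Q' : QuadraticForm k N) :
    (QuadraticForm.baseChange L (Q.prod Q')).Equivalent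
      ((Q.baseChange L).prod (Q'.baseChange L)) := by
  let E : (L ⊗[k] (M × N)) ≃ₗ[L] (L ⊗[k] M) × (L ⊗[k] N) := TensorProduct.prodRight k L L M N
  have key : ((Q.baseChange L).prod (Q'.baseChange L)).comp E.toLinearMap =
      QuadraticForm.baseChange L (Q.prod Q') := by
    refine baseChange_ext fun m => ?_
    simp [E, add_smul]
  exact ⟨{ E with map_app' := fun x => DFunLike.congr_fun key x }⟩
end

variable {k : Type u} [Field k] [Invertible (2 : k)]
variable (L : Type u) [Field L] [Invertible (2 : L)] [Algebra k L]

theorem baseChange_regular (q : RegularForm k) : (q.form.baseChange L).Nondegenerate := by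
  obtain ⟨x, hx⟩ : ∃ x, FormClass.mk q = x := ⟨_, rfl⟩
  induction x using FormClass.induction_unary generalizing q with
  | h0 =>
    have h : q.dim = 0 := by simpa using congrArg FormClass.dim hx
    have := Module.finrank_zero_iff.mp h
    exact regular_of_subsingleton _
  | h1 a x ih =>
    obtain ⟨p, rfl⟩ := FormClass.exists_rep x
    have e := FormClass.mk_eq_iff.mp (hx.trans (FormClass.mk_add _ _))
    refine regular_of_equivalent ((baseChange_equivalent L e).trans
      (baseChange_prod L _ _)).symm ?_
    exact regular_prod (regular_of_equivalent (baseChange_unaryForm L a).symm (regular_unary _))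
      (ih p rfl)

/-- The form `q` considered over the extension field `L`. -/
def baseChange (q : RegularForm k) : RegularForm L where
  carrier := L ⊗[k] q.carrier
  form := q.form.baseChange L
  regular := baseChange_regular L q

end RegularForm

namespace FormClass

open RegularForm

variable {k : Type u} [Field k] [Invertible (2 : k)]
variable (L : Type u) [Field L] [Invertible (2 : L)] [Algebra k L]

/-- Extension of scalars as an additive map on isometry classes. -/
def addMap : FormClass k →+ FormClass L where
  toFun := Quotient.map (RegularForm.baseChange L) fun _ _ h => baseChange_equivalent L h
  map_zero' := mk_eq_zero_of_subsingleton _ (inferInstanceAs (Subsingleton (L ⊗[k] PUnit.{u + 1})))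
  map_add' x y := by
    obtain ⟨p, rfl⟩ := exists_rep x
    obtain ⟨q, rfl⟩ := exists_rep y
    exact mk_eq_iff.mpr (baseChange_prod L p.form q.form)

/-- The unit of `L` given by a unit of `k`. -/
abbrev unitMap : kˣ →* Lˣ := Units.map (algebraMap k L).toMonoidHom

theorem addMap_unary (a : kˣ) : addMap L (mk (unary a)) = mk (unary (unitMap L a)) :=
  mk_eq_iff.mpr (baseChange_unaryForm L a)

/-- Extension of scalars as a homomorphism of semirings of isometry classes. -/
def map : FormClass k →+* FormClass L where
  __ := addMap L
  map_one' := by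
    change addMap L (mk (unary 1)) = _
    rw [addMap_unary, map_one]
    rfl
  map_mul' x y := by
    change addMap L (x * y) = addMap L x * addMap L y
    induction x using induction_unary with
    | h0 => simp
    | h1 a x hx =>
      rw [add_mul, map_add, map_add, add_mul, hx]
      congr 1
      clear hx
      induction y using induction_unary with
      | h0 => simp
      | h1 b y hy =>
        rw [mul_add, map_add, map_add, mul_add, hy, unary_mul_unary, addMap_unary, addMap_unary,
          addMap_unary, unary_mul_unary, map_mul]

theorem map_mk (q : RegularForm k) : map L (mk q) = mk (q.baseChange L) := rfl

theorem map_unary (a : kˣ) : map L (mk (unary a)) = mk (unary (unitMap L a)) :=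
  addMap_unary L a

theorem map_hyp : map L (hyp k) = hyp L := by
  rw [hyp_eq, hyp_eq, map_add, map_one, map_unary]
  congr 3
  ext
  simp

theorem dim_map (x : FormClass k) : dim (map L x) = dim x := by
  induction x using induction_unary with
  | h0 => simp
  | h1 a x hx => rw [map_add, map_add, map_add, map_unary, dim_unary, dim_unary, hx]

end FormClass

namespace RegularForm

variable {k : Type u} [Field k] [Invertible (2 : k)]
variable (L : Type u) [Field L] [Invertible (2 : L)] [Algebra k L]

@[simp] theorem dim_baseChange (q : RegularForm k) : (q.baseChange L).dim = q.dim :=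
  FormClass.dim_map L (FormClass.mk q)

end RegularForm

namespace WittRing

open RegularForm

variable {k : Type u} [Field k] [Invertible (2 : k)]
variable (L : Type u) [Field L] [Invertible (2 : L)] [Algebra k L]

/-- Extension of scalars as a homomorphism of Witt rings. -/
def map : WittRing k →+* WittRing L :=
  (wittCon k).lift (ofClass.comp (FormClass.map L)) (by
    rintro x y ⟨m, n, h⟩
    change ofClass (FormClass.map L x) = ofClass (FormClass.map L y)
    have h' := congrArg (fun z => ofClass (FormClass.map L z)) h
    simpa only [map_add, map_nsmul, FormClass.map_hyp, ofClass_hyp, smul_zero, add_zero] using h')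

theorem map_mk (q : RegularForm k) : map L (mk q) = mk (q.baseChange L) := rfl

theorem map_unary (a : kˣ) : map L (mk (unary a)) = mk (unary (FormClass.unitMap L a)) :=
  congrArg ofClass (FormClass.map_unary L a)

theorem map_map (F : Type u) [Field F] [Invertible (2 : F)] [Algebra k F] [Algebra F L]
    [IsScalarTower k F L] (x : WittRing k) : map L (map F x) = map L x := by
  obtain ⟨q, rfl⟩ := exists_rep x
  change ofClass (FormClass.map L (FormClass.map F (FormClass.mk q))) =
    ofClass (FormClass.map L (FormClass.mk q))
  congr 1
  induction FormClass.mk q using FormClass.induction_unary with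
  | h0 => simp
  | h1 a y ih =>
    rw [_root_.map_add, _root_.map_add, _root_.map_add, ih, FormClass.map_unary,
      FormClass.map_unary, FormClass.map_unary]
    congr 3
    ext
    exact (IsScalarTower.algebraMap_apply k F L a).symm

end WittRing

/-! ### Pfister forms -/

namespace FormClass

open RegularForm

variable {k : Type u} [Field k] [Invertible (2 : k)]

theorem exists_unary_add {x : FormClass k} (h : dim x ≠ 0) :
    ∃ (a : kˣ) (y : FormClass k), x = mk (unary a) + y := by
  induction x using induction_unary with
  | h0 => simp at h
  | h1 a y _ => exact ⟨a, y, rfl⟩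

theorem eq_zero_of_dim {x : FormClass k} (h : dim x = 0) : x = 0 := by
  obtain ⟨q, rfl⟩ := exists_rep x
  exact mk_eq_zero_of_dim h

/-- A one-dimensional form is determined by any of its non-zero values. -/
theorem mk_eq_unary_of_dim {q : RegularForm k} (hq : q.dim = 1) {a : kˣ} {x : q.carrier}
    (hx : q.form x = a) : mk q = mk (unary a) := by
  obtain ⟨p, hp, -⟩ := exists_split q a x hx
  have hd := congrArg dim hp
  simp only [map_add, dim_mk, hq, RegularForm.dim_unary] at hd
  rw [hp, mk_eq_zero_of_dim (q := p) (by omega), add_zero]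

theorem unary_mul_self (a : kˣ) : mk (unary (a * a)) = 1 := by
  rw [← mk_one]
  refine (mk_eq_unary_of_dim (RegularForm.dim_unary (1 : kˣ)) (x := show k from a) ?_).symm
  change unaryForm 1 (a : k) = _
  simp [unaryForm]

theorem unary_add_unary {a b c : kˣ} (h : (a : k) + b = c) :
    mk (unary a) + mk (unary b) = mk (unary c) * (1 + mk (unary (a * b))) := by
  obtain ⟨p, hp, hp'⟩ := exists_split ((unary a).orthSum (unary b)) c (show k × k from (1, 1)) (by
    change (unaryForm a).prod (unaryForm b) ((1 : k), (1 : k)) = _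
    simpa [unaryForm] using h)
  obtain ⟨u', hu'⟩ := hp' (show k × k from (b, -a)) (by
    change QuadraticMap.associated (R := k) ((unaryForm a).prod (unaryForm b)) ((1 : k), (1 : k))
      ((b : k), -(a : k)) = 0
    rw [QuadraticMap.associated_prod]
    simp [unaryForm]
    ring)
  have hv : ((unary a).orthSum (unary b)).form (show k × k from (b, -a)) =
      ((c * (a * b) : kˣ) : k) := by
    change (unaryForm a).prod (unaryForm b) ((b : k), -(a : k)) = _
    simp [unaryForm, ← h]
    ring
  have hd := congrArg dim hp
  simp only [map_add, dim_mk, dim_orthSum, RegularForm.dim_unary] at hd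
  rw [mk_add, hp, mk_eq_unary_of_dim (q := p) (by omega) (hu'.trans hv), mul_add, mul_one,
    unary_mul_unary]

end FormClass

namespace RegularForm

variable {k : Type u} [Field k] [Invertible (2 : k)]

theorem tensor_unary_equivalent_smul (a : kˣ) (q : RegularForm k) :
    ((unary a).tensor q).form.Equivalent ((a : k) • q.form) := by
  have key : ((a : k) • q.form).comp (TensorProduct.lid k q.carrier).toLinearMap =
      (unaryForm a).tmul q.form := by
    refine (QuadraticMap.associated_rightInverse k).injective ?_
    rw [QuadraticMap.associated_comp]
    erw [QuadraticForm.associated_tmul]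
    ext
    simp [unaryForm, mul_comm]
  exact ⟨{ TensorProduct.lid k q.carrier with
    map_app' := fun x => DFunLike.congr_fun key x }⟩

/-- The form `a • q`. -/
def scale (a : kˣ) (q : RegularForm k) : RegularForm k where
  carrier := q.carrier
  form := (a : k) • q.form
  regular := regular_of_equivalent (tensor_unary_equivalent_smul a q) ((unary a).tensor q).regular

theorem mk_scale (a : kˣ) (q : RegularForm k) :
    FormClass.mk (q.scale a) = FormClass.mk (unary a) * FormClass.mk q :=
  (FormClass.mk_eq_iff (p := (unary a).tensor q) (q := q.scale a) |>.mpr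
    (tensor_unary_equivalent_smul a q)).symm

/-- The Pfister form `⟨1, a₁⟩ ⊗ ⋯ ⊗ ⟨1, aₙ⟩`. -/
def pfister : List kˣ → RegularForm k
  | [] => unary 1
  | a :: l => (pfister l).orthSum ((pfister l).scale a)

theorem mk_pfister_cons (a : kˣ) (l : List kˣ) : FormClass.mk (pfister (a :: l)) =
    (1 + FormClass.mk (unary a)) * FormClass.mk (pfister l) := by
  rw [pfister, ← FormClass.mk_add, mk_scale]
  ring

theorem dim_pfister (l : List kˣ) : (pfister l).dim = 2 ^ l.length := by
  induction l with
  | nil => exact FormClass.dim_unary 1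
  | cons a l ih =>
    rw [pfister, dim_orthSum, List.length_cons, pow_succ, mul_two]
    exact congrArg₂ _ ih ih

/-- Pfister forms are round: the non-zero values are similarity factors. -/
theorem pfister_round (l : List kˣ) (c : kˣ) (x : (pfister l).carrier)
    (hx : (pfister l).form x = c) :
    FormClass.mk (unary c) * FormClass.mk (pfister l) = FormClass.mk (pfister l) := by
  induction l generalizing c with
  | nil =>
    have := FormClass.mk_eq_unary_of_dim (dim_pfister []) hx
    rw [← this, pfister, FormClass.mk_one, mul_one]
  | cons a l ih =>
    obtain ⟨X, Y⟩ := x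
    change (pfister l).form X + a * (pfister l).form Y = c at hx
    rw [mk_pfister_cons]
    by_cases hX : (pfister l).form X = 0
    · have hY : (pfister l).form Y ≠ 0 := fun h => c.ne_zero (by rw [← hx, hX, h]; simp)
      have hc : c = a * Units.mk0 _ hY := by ext; simp [← hx, hX]
      have h := ih _ Y (Units.val_mk0 hY).symm
      rw [hc, ← FormClass.unary_mul_unary]
      have ha := FormClass.unary_mul_self a
      rw [← FormClass.unary_mul_unary] at ha
      calc _ = (FormClass.mk (unary a) + FormClass.mk (unary a) * FormClass.mk (unary a)) *
            (FormClass.mk (unary (Units.mk0 _ hY)) * FormClass.mk (pfister l)) := by ring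
        _ = _ := by rw [h, ha]; ring
    · by_cases hY : (pfister l).form Y = 0
      · have h := ih c X (by rw [← hx, hY]; simp)
        rw [mul_left_comm, h]
      · have hs := ih _ X (Units.val_mk0 hX).symm
        have ht := ih _ Y (Units.val_mk0 hY).symm
        set s := Units.mk0 _ hX
        set t := Units.mk0 _ hY
        have h := FormClass.unary_add_unary (a := s) (b := a * t) (c := c) (by
          simpa [s, t] using hx)
        have e : (1 + FormClass.mk (unary a)) * FormClass.mk (pfister l) =
            (FormClass.mk (unary s) + FormClass.mk (unary (a * t))) *
              FormClass.mk (pfister l) := by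
          rw [← FormClass.unary_mul_unary, add_mul, add_mul, hs, mul_assoc, ht, one_mul]
        rw [mul_left_comm s a t, ← FormClass.unary_mul_unary a (s * t),
          ← FormClass.unary_mul_unary s t] at h
        symm
        calc _ = _ := e
          _ = FormClass.mk (unary c) * (FormClass.mk (pfister l) + FormClass.mk (unary a) *
              (FormClass.mk (unary s) * (FormClass.mk (unary t) * FormClass.mk (pfister l)))) := by
              rw [h]; ring
          _ = _ := by rw [ht, hs]; ring

theorem witt_mk_pfister_cons (a : kˣ) (l : List kˣ) :
    WittRing.mk (pfister (a :: l)) = (1 + WittRing.mk (unary a)) * WittRing.mk (pfister l) := by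
  change WittRing.ofClass _ = _
  rw [mk_pfister_cons, map_mul, map_add, map_one]
  rfl

/-- An isotropic Pfister form is hyperbolic. -/
theorem witt_pfister_eq_zero (l : List kˣ) (h : ¬ (pfister l).form.Anisotropic) :
    WittRing.mk (pfister l) = 0 := by
  induction l with
  | nil =>
    refine absurd (fun x hx => ?_) h
    change unaryForm 1 (show k from x) = 0 at hx
    have hx' : (1 : k) * ((show k from x) * (show k from x)) = 0 := hx
    rw [one_mul] at hx'
    exact mul_self_eq_zero.mp hx'
  | cons a l ih =>
    have hcons := witt_mk_pfister_cons a l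
    by_cases hl : (pfister l).form.Anisotropic
    · obtain ⟨⟨X, Y⟩, h0, hxy⟩ := (QuadraticMap.not_anisotropic_iff_exists _).mp h
      change (pfister l).form X + a * (pfister l).form Y = 0 at hxy
      have hX : (pfister l).form X ≠ 0 := by
        intro hX
        have hY : (pfister l).form Y = 0 := by simpa [hX] using hxy
        exact h0 (Prod.ext (hl _ hX) (hl _ hY))
      have hY : (pfister l).form Y ≠ 0 := by
        intro hY
        rw [hY, mul_zero, add_zero] at hxy
        exact hX hxy
      have hs := congrArg WittRing.ofClass (pfister_round l _ X (Units.val_mk0 hX).symm)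
      have ht := congrArg WittRing.ofClass (pfister_round l _ Y (Units.val_mk0 hY).symm)
      rw [map_mul] at hs ht
      change WittRing.mk (unary _) * WittRing.mk _ = WittRing.mk _ at hs ht
      have hst : Units.mk0 _ hX = -(a * Units.mk0 _ hY) := by
        ext
        simp only [Units.val_mk0, Units.val_neg, Units.val_mul]
        linear_combination hxy
      rw [hst, ← WittRing.neg_unary, ← WittRing.unary_mul_unary] at hs
      rw [hcons]
      linear_combination -hs - WittRing.mk (unary a) * ht
    · rw [hcons, ih hl, mul_zero]

variable (L : Type u) [Field L] [Invertible (2 : L)] [Algebra k L]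

theorem map_mk_pfister (l : List kˣ) : FormClass.map L (FormClass.mk (pfister l)) =
    FormClass.mk (pfister (l.map (FormClass.unitMap L))) := by
  induction l with
  | nil => exact (FormClass.map L).map_one
  | cons a l ih =>
    rw [mk_pfister_cons, List.map_cons, mk_pfister_cons, map_mul, map_add, map_one,
      FormClass.map_unary, ih]

theorem equivalent_of_mk_eq_sum_unary {n : ℕ} {w : Fin n → kˣ} {q : RegularForm k}
    (h : FormClass.mk q = ∑ i, FormClass.mk (unary (w i))) :
    (QuadraticMap.weightedSumSquares k w).Equivalent q.form := by
  obtain ⟨p, hp, hpw⟩ := FormClass.exists_diagonal n w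
  exact hp.trans (FormClass.mk_eq_iff.mp (hpw.trans h.symm))

/-- A Pfister form becomes trivial in the Witt ring of every extension over which it is
isotropic. -/
theorem map_witt_pfister_eq_zero {l : List kˣ} {n : ℕ} {w : Fin n → kˣ}
    (h : FormClass.mk (pfister l) = ∑ i, FormClass.mk (unary (w i))) (x : Fin n → L) (hx : x ≠ 0)
    (hx0 : ∑ i, algebraMap k L (w i) * x i ^ 2 = 0) :
    WittRing.map L (WittRing.mk (pfister l)) = 0 := by
  have hmap := map_mk_pfister L l
  have e : WittRing.map L (WittRing.mk (pfister l)) =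
      WittRing.mk (pfister (l.map (FormClass.unitMap L))) := congrArg WittRing.ofClass hmap
  rw [e]
  apply witt_pfister_eq_zero
  rw [h, map_sum] at hmap
  simp only [FormClass.map_unary] at hmap
  obtain ⟨f⟩ := equivalent_of_mk_eq_sum_unary hmap.symm
  intro hani
  refine hx (f.toLinearEquiv.map_eq_zero_iff.mp (hani (f x) ?_))
  rw [f.map_app, QuadraticMap.weightedSumSquares_apply, ← hx0]
  refine Finset.sum_congr rfl fun i _ => ?_
  rw [Units.smul_def, smul_eq_mul, pow_two]
  rfl

end RegularForm

namespace WittRing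

open RegularForm

variable {k : Type u} [Field k] [Invertible (2 : k)]

/-- `IsPfisterSum n s x`: the element `x` of the Witt ring is a sum of `s` classes of scalar
multiples of `n`-fold Pfister forms. -/
inductive IsPfisterSum (n : ℕ) : ℕ → WittRing k → Prop
  | zero : IsPfisterSum n 0 0
  | add {s : ℕ} {x : WittRing k} (a : kˣ) (l : List kˣ) (hl : l.length = n)
      (h : IsPfisterSum n s x) : IsPfisterSum n (s + 1) (mk (unary a) * mk (pfister l) + x)

theorem IsPfisterSum.map (L : Type u) [Field L] [Invertible (2 : L)] [Algebra k L] {n s : ℕ}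
    {x : WittRing k} (h : IsPfisterSum n s x) : IsPfisterSum n s (WittRing.map L x) := by
  induction h with
  | zero => rw [map_zero]; exact .zero
  | add a l hl _ ih =>
    have e : WittRing.map L (mk (pfister l)) = mk (pfister (l.map (FormClass.unitMap L))) :=
      congrArg ofClass (map_mk_pfister L l)
    rw [map_add, map_mul, map_unary, e]
    exact .add _ _ (by simpa using hl) ih

theorem mem_closure_of_even (x : FormClass k) (hx : Even (FormClass.dim x)) :
    ofClass x ∈ AddSubmonoid.closure
      {y : WittRing k | ∃ a b : kˣ, y = mk (unary a) * (1 + mk (unary b))} := by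
  induction h : FormClass.dim x using Nat.strong_induction_on generalizing x with
  | _ n ih =>
    by_cases h0 : FormClass.dim x = 0
    · rw [FormClass.eq_zero_of_dim h0, map_zero]
      exact zero_mem _
    · obtain ⟨a, y, rfl⟩ := FormClass.exists_unary_add h0
      rw [map_add, FormClass.dim_unary] at hx h
      obtain ⟨b, z, rfl⟩ := FormClass.exists_unary_add (x := y) (by
        intro h; rw [h] at hx; simp at hx)
      rw [map_add, FormClass.dim_unary] at hx h
      have hz := ih _ (by omega) z (by rw [Nat.even_iff] at hx ⊢; omega) rfl
      have e : ofClass (FormClass.mk (unary a) + (FormClass.mk (unary b) + z)) =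
          mk (unary a) * (1 + mk (unary (a⁻¹ * b))) + ofClass z := by
        rw [mul_add, mul_one, unary_mul_unary, mul_inv_cancel_left, map_add, map_add, ← add_assoc]
        rfl
      rw [e]
      exact add_mem (AddSubmonoid.subset_closure ⟨a, _, rfl⟩) hz

theorem mem_closure_pfister_of_mem_pow (n : ℕ) {x : WittRing k} (hx : x ∈ fundamentalIdeal k ^ n) :
    x ∈ AddSubmonoid.closure {y : WittRing k | ∃ (a : kˣ) (l : List kˣ), l.length = n ∧
      y = mk (unary a) * mk (pfister l)} := by
  induction n generalizing x with
  | zero =>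
    obtain ⟨q, rfl⟩ := exists_rep x
    change ofClass (FormClass.mk q) ∈ _
    induction FormClass.mk q using FormClass.induction_unary with
    | h0 => rw [map_zero]; exact zero_mem _
    | h1 a y ih =>
      rw [map_add]
      refine add_mem (AddSubmonoid.subset_closure ⟨a, [], rfl, ?_⟩) ih
      rw [pfister, mk_one, mul_one]
      rfl
  | succ n ih =>
    rw [pow_succ] at hx
    refine Submodule.mul_induction_on hx (fun x hx y hy => ?_) fun x y hx hy => add_mem hx hy
    obtain ⟨q, hq, rfl⟩ := hy
    have hy := mem_closure_of_even (FormClass.mk q) hq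
    change ofClass _ ∈ _ at hy
    change x * ofClass (FormClass.mk q) ∈ _
    generalize ofClass (FormClass.mk q) = y at hy
    have hx' := ih hx
    clear hx
    induction hx' using AddSubmonoid.closure_induction with
    | zero => rw [zero_mul]; exact zero_mem _
    | add x z _ _ h1 h2 => rw [add_mul]; exact add_mem h1 h2
    | mem x hx =>
      induction hy using AddSubmonoid.closure_induction with
      | zero => rw [mul_zero]; exact zero_mem _
      | add y z _ _ h1 h2 => rw [mul_add]; exact add_mem h1 h2
      | mem y hy =>
        obtain ⟨a, l, hl, rfl⟩ := hx
        obtain ⟨b, c, rfl⟩ := hy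
        refine AddSubmonoid.subset_closure ⟨a * b, c :: l, by simp [hl], ?_⟩
        rw [witt_mk_pfister_cons, ← unary_mul_unary]
        ring

/-- The `n`-th power of the fundamental ideal is additively generated by the scalar multiples of
`n`-fold Pfister forms. -/
theorem exists_isPfisterSum (n : ℕ) {x : WittRing k} (hx : x ∈ fundamentalIdeal k ^ n) :
    ∃ s, IsPfisterSum n s x := by
  have h := mem_closure_pfister_of_mem_pow n hx
  clear hx
  induction h using AddSubmonoid.closure_induction_left with
  | zero => exact ⟨0, .zero⟩
  | add_left x hx y _ ih =>
    obtain ⟨a, l, hl, rfl⟩ := hx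
    obtain ⟨s, hs⟩ := ih
    exact ⟨s + 1, .add a l hl hs⟩

end WittRing

/-! ### The theorem of Cassels and Pfister -/

namespace Matrix

open Polynomial

section Value

variable {ι : Type*} [Fintype ι] {R S : Type*} [CommRing R] [CommRing S]

/-- The bilinear form with Gram matrix `A`. -/
def bilin (A : Matrix ι ι R) (x y : ι → R) : R := x ⬝ᵥ A *ᵥ y

theorem bilin_add_left (A : Matrix ι ι R) (x y z : ι → R) :
    A.bilin (x + y) z = A.bilin x z + A.bilin y z := add_dotProduct _ _ _

theorem bilin_add_right (A : Matrix ι ι R) (x y z : ι → R) :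
    A.bilin x (y + z) = A.bilin x y + A.bilin x z := by
  simp [bilin, mulVec_add, dotProduct_add]

theorem bilin_smul_left (A : Matrix ι ι R) (c : R) (x y : ι → R) :
    A.bilin (c • x) y = c * A.bilin x y := by simp [bilin]

theorem bilin_smul_right (A : Matrix ι ι R) (c : R) (x y : ι → R) :
    A.bilin x (c • y) = c * A.bilin x y := by simp [bilin, mulVec_smul]

theorem bilin_sub_left (A : Matrix ι ι R) (x y z : ι → R) :
    A.bilin (x - y) z = A.bilin x z - A.bilin y z := sub_dotProduct _ _ _

theorem bilin_sub_right (A : Matrix ι ι R) (x y z : ι → R) :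
    A.bilin x (y - z) = A.bilin x y - A.bilin x z := by
  simp [bilin, mulVec_sub, dotProduct_sub]

theorem bilin_comm {A : Matrix ι ι R} (hA : A.IsSymm) (x y : ι → R) :
    A.bilin x y = A.bilin y x := by
  rw [bilin, dotProduct_mulVec, ← mulVec_transpose, hA.eq, dotProduct_comm, bilin]

theorem bilin_eq_sum (A : Matrix ι ι R) (x y : ι → R) :
    A.bilin x y = ∑ i, ∑ j, x i * (A i j * y j) := by
  simp [bilin, dotProduct, mulVec, Finset.mul_sum]

theorem map_bilin (f : R →+* S) (A : Matrix ι ι R) (x y : ι → R) :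
    (A.map f).bilin (f ∘ x) (f ∘ y) = f (A.bilin x y) := by
  simp [bilin_eq_sum]

/-- The quadratic form with Gram matrix `A` has no non-trivial zero. -/
def Aniso (A : Matrix ι ι R) : Prop := ∀ x, A.bilin x x = 0 → x = 0

end Value

section Field

variable {ι : Type*} [Fintype ι] {F : Type*} [Field F]

/-- If `d` bounds the degrees of the entries of `f`, the coefficient of degree `2d` of the value
of the form at `f` is the value at the vector of the coefficients of degree `d`. -/
theorem coeff_bilin_map_C (A : Matrix ι ι F) (f : ι → F[X]) (d : ℕ)
    (hf : ∀ i, (f i).natDegree ≤ d) :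
    ((A.map C).bilin f f).coeff (d + d) = A.bilin (fun i => (f i).coeff d)
      (fun i => (f i).coeff d) := by
  simp only [bilin_eq_sum, finsetSum_coeff, map_apply]
  refine Finset.sum_congr rfl fun i _ => Finset.sum_congr rfl fun j _ => ?_
  rw [coeff_mul_add_eq_of_natDegree_le (hf i) ((natDegree_C_mul_le _ _).trans (hf j)), coeff_C_mul]

theorem natDegree_bilin_map_C_le (A : Matrix ι ι F) (f : ι → F[X]) (d : ℕ)
    (hf : ∀ i, (f i).natDegree ≤ d) : ((A.map C).bilin f f).natDegree ≤ d + d := by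
  rw [bilin_eq_sum]
  refine natDegree_sum_le_of_forall_le _ _ fun i _ =>
    natDegree_sum_le_of_forall_le _ _ fun j _ => ?_
  exact natDegree_mul_le_of_le (hf i) ((natDegree_C_mul_le _ _).trans (hf j))

/-- The leading terms of the entries of `f` do not cancel in the value of an anisotropic form. -/
theorem Aniso.natDegree_le {A : Matrix ι ι F} (hA : A.Aniso) (f : ι → F[X]) (e : ℕ)
    (h : ((A.map C).bilin f f).natDegree ≤ e + e) (i : ι) : (f i).natDegree ≤ e := by
  by_contra! hi
  obtain ⟨j, -, hj⟩ := Finset.exists_max_image Finset.univ (fun i => (f i).natDegree)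
    ⟨i, Finset.mem_univ _⟩
  have hd := coeff_bilin_map_C A f (f j).natDegree fun i => hj i (Finset.mem_univ _)
  have hij := hj i (Finset.mem_univ _)
  rw [coeff_eq_zero_of_natDegree_lt (by omega)] at hd
  have := congrFun (hA _ hd.symm) j
  simp only [Pi.zero_apply, coeff_natDegree, leadingCoeff_eq_zero] at this
  rw [this] at hij
  simp at hij
  omega

theorem Aniso.map_C {A : Matrix ι ι F} (hA : A.Aniso) : (A.map (C : F →+* F[X])).Aniso := by
  intro f hf
  have h0 := hA.natDegree_le f 0 (by simp [hf])
  have hd := coeff_bilin_map_C A f 0 h0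
  rw [hf] at hd
  have := hA _ hd.symm
  ext1 i
  rw [eq_C_of_natDegree_le_zero (h0 i)]
  simp [congrFun this i]

theorem exists_common_denominator {R K κ : Type*} [CommRing R] [IsDomain R] [Field K]
    [Algebra R K] [IsFractionRing R K] [Finite κ] (x : κ → K) :
    ∃ (g : R) (f : κ → R), g ≠ 0 ∧ algebraMap R K ∘ f = algebraMap R K g • x := by
  obtain ⟨g, hg⟩ := IsLocalization.exist_integer_multiples_of_finite (nonZeroDivisors R) x
  choose f hf using hg
  exact ⟨g, f, nonZeroDivisors.coe_ne_zero g, funext fun i => by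
    simp [hf i, Algebra.smul_def]⟩

theorem Aniso.map_fractionRing {A : Matrix ι ι F} (hA : A.Aniso) :
    (A.map (algebraMap F (FractionRing F[X]))).Aniso := by
  intro x hx
  obtain ⟨g, f, hg, hf⟩ := exists_common_denominator (R := F[X]) x
  have hg' : algebraMap F[X] (FractionRing F[X]) g ≠ 0 := by simpa using hg
  have e : A.map (algebraMap F (FractionRing F[X])) =
      (A.map (C : F →+* F[X])).map (algebraMap F[X] (FractionRing F[X])) := by
    ext i j; rfl
  have h : (A.map (C : F →+* F[X])).bilin f f = 0 := by
    apply IsFractionRing.injective F[X] (FractionRing F[X])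
    rw [← map_bilin, ← e, hf, bilin_smul_left, bilin_smul_right, hx]
    simp
  have := hA.map_C _ h
  rw [this] at hf
  ext1 i
  have := congrFun hf i
  simpa [hg] using this.symm

/-- One step of the descent of Cassels and Pfister: a representation of `p` with denominator `g`
of positive degree is replaced by one with a denominator of smaller degree. If `g` does not divide
`f`, it is the second intersection of the quadric of the vectors of value `p` with the line
through `f / g` and its polynomial part. -/
theorem exists_smaller_denominator {A : Matrix ι ι F} (hA : A.Aniso) (hs : A.IsSymm) (p g : F[X])
    (f : ι → F[X]) (hg : g.natDegree ≠ 0) (hf : (A.map C).bilin f f = p * g ^ 2) :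
    ∃ (g' : F[X]) (f' : ι → F[X]), g' ≠ 0 ∧ g'.natDegree < g.natDegree ∧
      (A.map C).bilin f' f' = p * g' ^ 2 := by
  have hg0 : g ≠ 0 := fun h => hg (by simp [h])
  let h : ι → F[X] := fun i => f i / g
  let r : ι → F[X] := fun i => f i % g
  have hfr : f = g • h + r := by
    ext1 i
    exact (EuclideanDomain.div_add_mod _ _).symm
  have hsC : (A.map (C : F →+* F[X])).IsSymm := hs.map _
  set B := (A.map (C : F →+* F[X])).bilin with hB
  by_cases hr : r = 0
  · refine ⟨1, h, one_ne_zero, by simpa using Nat.pos_of_ne_zero hg, ?_⟩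
    rw [hr, add_zero] at hfr
    rw [hfr, hB, bilin_smul_left, bilin_smul_right, ← hB] at hf
    have : g ^ 2 * B h h = g ^ 2 * p := by linear_combination hf
    simpa using mul_left_cancel₀ (pow_ne_zero 2 hg0) this
  · let a := B h h - p
    let b := 2 * (p * g - B f h)
    let g' := a * g + b
    have hBr : B r r = B f f - 2 * g * B f h + g ^ 2 * B h h := by
      have : r = f - g • h := by rw [hfr]; simp
      rw [this, hB, bilin_sub_left, bilin_sub_right, bilin_sub_right, bilin_smul_left,
        bilin_smul_right, bilin_smul_left, bilin_smul_right, bilin_comm hsC h f]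
      ring
    have hgg : g * g' = B r r := by
      rw [hBr, hf]
      ring
    have hr0 : B r r ≠ 0 := fun h0 => hr (hA.map_C _ h0)
    have hg'0 : g' ≠ 0 := by
      rintro h0
      rw [h0, mul_zero] at hgg
      exact hr0 hgg.symm
    refine ⟨g', a • f + b • h, hg'0, ?_, ?_⟩
    · have hdeg := natDegree_bilin_map_C_le A r (g.natDegree - 1) fun i =>
        Nat.le_sub_one_of_lt (natDegree_mod_lt _ hg)
      rw [← hB, ← hgg, natDegree_mul hg0 hg'0] at hdeg
      omega
    · rw [hB, bilin_add_left, bilin_add_right, bilin_add_right, bilin_smul_left, bilin_smul_left,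
        bilin_smul_left, bilin_smul_left, bilin_smul_right, bilin_smul_right, bilin_smul_right,
        bilin_smul_right, bilin_comm hsC h f, ← hB, hf]
      ring

/-- The theorem of Cassels and Pfister for an anisotropic form with Gram matrix `A`: a polynomial
represented over `F(t)` is represented over `F[t]`. -/
theorem cassels_pfister {A : Matrix ι ι F} (hA : A.Aniso) (hs : A.IsSymm) (p : F[X])
    (y : ι → FractionRing F[X])
    (hy : (A.map (algebraMap F (FractionRing F[X]))).bilin y y = algebraMap F[X] _ p) :
    ∃ f : ι → F[X], (A.map C).bilin f f = p := by
  obtain ⟨g, f, hg, hf⟩ := exists_common_denominator (R := F[X]) y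
  have e : A.map (algebraMap F (FractionRing F[X])) =
      (A.map (C : F →+* F[X])).map (algebraMap F[X] (FractionRing F[X])) := by
    ext i j; rfl
  have h : (A.map (C : F →+* F[X])).bilin f f = p * g ^ 2 := by
    apply IsFractionRing.injective F[X] (FractionRing F[X])
    rw [← map_bilin, ← e, hf, bilin_smul_left, bilin_smul_right, hy]
    simp
    ring
  clear hf hy y e
  induction hd : g.natDegree using Nat.strong_induction_on generalizing f g with
  | _ d ih =>
    by_cases h0 : g.natDegree = 0
    · obtain ⟨c, rfl⟩ := natDegree_eq_zero.mp h0
      have hc : c ≠ 0 := by rintro rfl; simp at hg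
      refine ⟨C c⁻¹ • f, ?_⟩
      rw [bilin_smul_left, bilin_smul_right, h]
      have : C c⁻¹ * C c = 1 := by rw [← C_mul, inv_mul_cancel₀ hc, C_1]
      linear_combination p * (C c⁻¹ * C c + 1) * this
    · obtain ⟨g', f', hg', hlt, hf'⟩ := exists_smaller_denominator hA hs p g f h0 h
      exact ih _ (hd ▸ hlt) g' f' hg' hf' rfl

/-- A form representing `α + β t²` over `F(t)` has two orthogonal vectors of values `α` and
`β`. -/
theorem exists_orthogonal_of_eq_add_mul_sq {A : Matrix ι ι F} (hA : A.Aniso) (hs : A.IsSymm)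
    (h2 : (2 : F) ≠ 0) (α β : F) (y : ι → FractionRing F[X])
    (hy : (A.map (algebraMap F (FractionRing F[X]))).bilin y y =
      algebraMap F _ α + algebraMap F _ β * algebraMap F[X] _ X ^ 2) :
    ∃ u v : ι → F, A.bilin u u = α ∧ A.bilin v v = β ∧ A.bilin u v = 0 := by
  obtain ⟨f, hf⟩ := cassels_pfister hA hs (C α + C β * X ^ 2) y (by
    rw [hy, map_add, map_mul, map_pow]; rfl)
  have hd := hA.natDegree_le f 1 (by
    rw [hf]
    exact natDegree_add_le_of_degree_le (by simp) (natDegree_C_mul_X_pow_le _ _))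
  let u : ι → F := fun i => (f i).coeff 0
  let v : ι → F := fun i => (f i).coeff 1
  have hfuv : f = (C : F →+* F[X]) ∘ u + (X : F[X]) • ((C : F →+* F[X]) ∘ v) := by
    ext1 i
    rw [eq_X_add_C_of_natDegree_le_one (hd i)]
    simp [u, v]
    ring
  rw [hfuv, bilin_add_left, bilin_add_right, bilin_add_right, bilin_smul_left, bilin_smul_left,
    bilin_smul_right, bilin_smul_right, map_bilin, map_bilin, map_bilin, map_bilin,
    bilin_comm hs v u] at hf
  have hf' : C (A.bilin u u) + C (2 * A.bilin u v) * X + C (A.bilin v v) * X ^ 2 =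
      C α + C β * X ^ 2 := by
    rw [← hf, C_mul]
    simp only [map_ofNat]
    ring
  refine ⟨u, v, ?_, ?_, ?_⟩
  · simpa using congrArg (fun p : F[X] => p.coeff 0) hf'
  · simpa [coeff_X, coeff_C] using congrArg (fun p : F[X] => p.coeff 2) hf'
  · simpa [coeff_X, coeff_C, h2] using congrArg (fun p : F[X] => p.coeff 1) hf'

end Field

end Matrix

/-! ### The subform theorem over a rational function field -/

namespace Matrix

open Polynomial

variable {ι κ : Type*} [Fintype ι] [Fintype κ]

theorem bilin_transpose_mul_mul {R : Type*} [CommRing R] (A : Matrix ι ι R) (E : Matrix ι κ R)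
    (x y : κ → R) : (Eᵀ * A * E).bilin x y = A.bilin (E *ᵥ x) (E *ᵥ y) := by
  rw [bilin, bilin, Matrix.mul_assoc, ← mulVec_mulVec, ← mulVec_mulVec, mulVec_transpose,
    dotProduct_comm, ← dotProduct_mulVec, dotProduct_comm]

variable {K F : Type*} [Field K] [Field F]

theorem bilin_fromBlocks_elim {R : Type*} [CommRing R] (A : Matrix ι ι R) (c : R) (x : ι → R)
    (s : R) : (fromBlocks A 0 0 (Matrix.of fun _ _ : Unit => c)).bilin
      (Sum.elim x fun _ => s) (Sum.elim x fun _ => s) = A.bilin x x + c * s ^ 2 := by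
  rw [bilin, fromBlocks_mulVec, sumElim_dotProduct_sumElim]
  simp [bilin, dotProduct, mulVec]
  ring

/-- If all anisotropic forms over `K` stay anisotropic under `f : K →+* F`, then anisotropic forms
represent no new elements of `K` over `F`. -/
theorem Aniso.exists_bilin_eq_of_map {ι : Type} [Fintype ι] (f : K →+* F)
    (hf : ∀ {κ : Type} [Fintype κ] (A : Matrix κ κ K), A.Aniso → (A.map f).Aniso)
    {A : Matrix ι ι K} (hA : A.Aniso) (b : K) (v : ι → F)
    (hv : (A.map f).bilin v v = f b) : ∃ v₀ : ι → K, A.bilin v₀ v₀ = b := by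
  by_contra! hno
  -- The form `A ⊥ ⟨-b⟩` is anisotropic over `K`, but `(v, 1)` is a zero of it over `F`.
  have hblock : (fromBlocks A 0 0 (Matrix.of fun _ _ : Unit => -b)).Aniso := by
    intro z hz
    obtain ⟨x, s, rfl⟩ : ∃ (x : ι → K) (s : K), z = Sum.elim x fun _ => s :=
      ⟨z ∘ Sum.inl, z (Sum.inr ()), by ext i; rcases i with i | i <;> rfl⟩
    rw [bilin_fromBlocks_elim] at hz
    by_cases hs : s = 0
    · subst hs
      have := hA x (by simpa using hz)
      subst this
      ext i
      rcases i with i | i <;> rfl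
    · exfalso
      refine hno (s⁻¹ • x) ?_
      rw [bilin_smul_left, bilin_smul_right]
      field_simp
      linear_combination hz
  have := hf _ hblock
  rw [fromBlocks_map] at this
  have h0 := this (Sum.elim v fun _ => 1) (by
    have h := bilin_fromBlocks_elim (A.map f) (f (-b)) v 1
    rw [hv] at h
    simp only [map_neg, one_pow, mul_one, add_neg_cancel] at h
    rw [← h]
    congr 1
    ext i j
    rcases i with i | i <;> rcases j with j | j <;> simp)
  have := congrFun h0 (Sum.inr ())
  simp at this

/-- A reflection carrying `v` to `v₀` carries the vectors orthogonal to `v` to vectors orthogonal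
to `v₀`. -/
theorem Aniso.exists_orthogonal_of_bilin_eq {A : Matrix ι ι F} (hA : A.Aniso) (hs : A.IsSymm)
    {u v v₀ : ι → F} (hv : A.bilin v v = A.bilin v₀ v₀) (huv : A.bilin u v = 0) :
    ∃ u', A.bilin u' u' = A.bilin u u ∧ A.bilin u' v₀ = 0 := by
  by_cases h : v - v₀ = 0
  · rw [sub_eq_zero] at h
    exact ⟨u, rfl, h ▸ huv⟩
  · have hD : A.bilin (v - v₀) (v - v₀) ≠ 0 := fun h0 => h (hA _ h0)
    have hD' : A.bilin (v - v₀) (v - v₀) = -(2 * A.bilin (v - v₀) v₀) := by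
      simp only [bilin_sub_left, bilin_sub_right, bilin_comm hs v₀ v]
      linear_combination hv
    have hud : A.bilin u (v - v₀) = - A.bilin u v₀ := by
      rw [bilin_sub_right, huv, zero_sub]
    refine ⟨u - (2 * A.bilin u (v - v₀) / A.bilin (v - v₀) (v - v₀)) • (v - v₀), ?_, ?_⟩
    · generalize v - v₀ = d at *
      rw [bilin_sub_left, bilin_sub_right, bilin_sub_right, bilin_smul_left, bilin_smul_left,
        bilin_smul_right, bilin_smul_right, bilin_comm hs d u]
      field_simp
      ring
    · rw [bilin_sub_left, bilin_smul_left, hud]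
      field_simp
      rw [hD']
      ring

open Classical in
/-- The orthogonal complement of a vector of non-zero value is parametrized by all but one of the
coordinates, over every extension field. -/
theorem Aniso.exists_complement {K F : Type u} [Field K] [Field F] {A : Matrix ι ι K}
    (hA : A.Aniso) (hs : A.IsSymm) (v₀ : ι → K)
    (hv₀ : A.bilin v₀ v₀ ≠ 0) : ∃ (j : ι) (A' : Matrix {i // i ≠ j} {i // i ≠ j} K),
      A'.IsSymm ∧ A'.Aniso ∧ ∀ (f : K →+* F) (u : ι → F), (A.map f).bilin u (f ∘ v₀) = 0 →
        ∃ w, (A'.map f).bilin w w = (A.map f).bilin u u := by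
  let g := A *ᵥ v₀
  obtain ⟨j, hj⟩ : ∃ j, g j ≠ 0 := by
    by_contra! h
    have : g = 0 := funext h
    exact hv₀ (by rw [bilin]; change v₀ ⬝ᵥ g = 0; rw [this, dotProduct_zero])
  -- The linear equation `∑ i, u i * g i = 0` of the complement is solved for `u j`.
  let E : Matrix ι {i // i ≠ j} K :=
    Matrix.of fun i l => if i = j then -(g l / g j) else if i = l then 1 else 0
  have hE : ∀ {R : Type u} [Field R] (f : K →+* R) (w : {i // i ≠ j} → R) (l : {i // i ≠ j}),
      (E.map f *ᵥ w) l = w l := by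
    intro R _ f w l
    rw [mulVec, dotProduct, Finset.sum_eq_single l]
    · simp [E, l.2]
    · intro m _ hm
      simp [E, l.2, Subtype.coe_inj, Ne.symm hm]
    · simp
  refine ⟨j, Eᵀ * A * E, ?_, ?_, ?_⟩
  · rw [IsSymm, transpose_mul, transpose_mul, transpose_transpose, hs.eq, Matrix.mul_assoc]
  · intro w hw
    rw [bilin_transpose_mul_mul] at hw
    have := hA _ hw
    ext l
    have h := hE (RingHom.id K) w l
    rw [← h]
    simpa using congrFun this l
  · intro f u hu
    refine ⟨fun l => u l, ?_⟩
    have hmap : (Eᵀ * A * E).map f = (E.map f)ᵀ * A.map f * E.map f := by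
      rw [Matrix.map_mul, Matrix.map_mul, transpose_map]
    rw [hmap, bilin_transpose_mul_mul]
    have huE : E.map f *ᵥ (fun l => u l) = u := by
      ext i
      by_cases hi : i = j
      · subst hi
        have hg : A.map f *ᵥ (f ∘ v₀) = f ∘ g := by
          ext i
          exact (RingHom.map_mulVec f A v₀ i).symm
        rw [bilin, hg, dotProduct, ← Fintype.sum_subtype_add_sum_subtype (· ≠ i)] at hu
        have hfg : f (g i) ≠ 0 := by simpa using hj
        have hrest : ∑ l : {x // ¬ x ≠ i}, u l * (f ∘ g) l = u i * f (g i) := by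
          rw [Fintype.sum_eq_single ⟨i, by simp⟩]
          · rfl
          · rintro ⟨x, hx⟩ h
            exact absurd (Subtype.ext (not_not.mp hx)) h
        rw [hrest] at hu
        have : (E.map f *ᵥ fun l => u l) i = -(∑ l : {x // x ≠ i}, u l * (f ∘ g) l) / f (g i) := by
          rw [mulVec, dotProduct, neg_div, Finset.sum_div, ← Finset.sum_neg_distrib]
          refine Finset.sum_congr rfl fun l _ => ?_
          simp [E]
          ring
        rw [this, div_eq_iff hfg]
        linear_combination -hu
      · exact hE f _ ⟨i, hi⟩
    rw [huE]

/-- A purely transcendental extension `F` of `K` of degree `N`, with generators `x i`, as far as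
needed here: anisotropic forms stay anisotropic over `F`, and an anisotropic form over `K`
representing a generic value `∑ i, b i * x i ^ 2` of an `N`-dimensional form has dimension at
least `N`. -/
theorem exists_generic_extension (K : Type u) [Field K] (h2 : (2 : K) ≠ 0) (N : ℕ) :
    ∃ (F : Type u) (_ : Field F) (_ : Algebra K F) (x : Fin N → F), (∀ i, x i ≠ 0) ∧
      (∀ {ι : Type} [Fintype ι] (A : Matrix ι ι K),
        A.Aniso → (A.map (algebraMap K F)).Aniso) ∧
      ∀ {ι : Type} [Fintype ι] (A : Matrix ι ι K), A.IsSymm → A.Aniso →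
        ∀ (b : Fin N → K) (y : ι → F), (∀ i, b i ≠ 0) →
          (A.map (algebraMap K F)).bilin y y = ∑ i, algebraMap K F (b i) * x i ^ 2 →
          N ≤ Fintype.card ι := by
  induction N with
  | zero =>
    refine ⟨K, inferInstance, Algebra.id K, fun i => i.elim0, fun i => i.elim0, ?_, ?_⟩
    · intro ι _ A hA
      simpa using hA
    · intros
      exact Nat.zero_le _
  | succ N ih =>
    obtain ⟨F, _, _, x, hx, hani, hrep⟩ := ih
    let F' := FractionRing F[X]
    let φ := algebraMap F F'
    let t : F' := algebraMap F[X] F' X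
    let : Algebra K F' := (φ.comp (algebraMap K F)).toAlgebra
    have halg : ∀ a, algebraMap K F' a = φ (algebraMap K F a) := fun _ => rfl
    have hmap : ∀ {ι : Type} [Fintype ι] (A : Matrix ι ι K),
        A.map (algebraMap K F') = (A.map (algebraMap K F)).map φ := fun A => by
      ext i j; rfl
    refine ⟨F', inferInstance, inferInstance, Fin.snoc (fun i => φ (x i)) t, ?_, ?_, ?_⟩
    · intro i
      refine Fin.lastCases ?_ (fun i => ?_) i
      · rw [Fin.snoc_last]
        simp [t]
      · rw [Fin.snoc_castSucc]
        simpa using hx i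
    · intro ι _ A hA
      rw [hmap]
      exact (hani A hA).map_fractionRing
    · intro ι _ A hs hA b y hb hy
      classical
      have h2' : (2 : F) ≠ 0 := by
        rw [← map_ofNat (algebraMap K F) 2]
        simpa using h2
      rw [hmap, Fin.sum_univ_castSucc] at hy
      simp only [Fin.snoc_castSucc, Fin.snoc_last, halg] at hy
      have hs' := hs.map (algebraMap K F)
      obtain ⟨u, v, hu, hv, huv⟩ := exists_orthogonal_of_eq_add_mul_sq (hani A hA) hs' h2'
        (∑ i : Fin N, algebraMap K F (b i.castSucc) * x i ^ 2) (algebraMap K F (b (Fin.last N)))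
        y (by rw [hy, map_sum]; simp only [map_mul, map_pow]; rfl)
      obtain ⟨v₀, hv₀⟩ := hA.exists_bilin_eq_of_map (algebraMap K F) hani _ v hv
      obtain ⟨u', hu', huv'⟩ := (hani A hA).exists_orthogonal_of_bilin_eq hs'
        (v₀ := algebraMap K F ∘ v₀) (by rw [hv, map_bilin, hv₀]) huv
      obtain ⟨j, A', hsA', hA', hcomp⟩ := hA.exists_complement (F := F) hs v₀ (by
        rw [hv₀]; exact hb _)
      obtain ⟨w, hw⟩ := hcomp _ u' huv'
      have := hrep A' hsA' hA' (fun i => b i.castSucc) w (fun i => hb _) (by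
        rw [hw, hu', hu])
      rw [Fintype.card_subtype_compl, Fintype.card_subtype_eq] at this
      have hpos : 0 < Fintype.card ι := Fintype.card_pos_iff.mpr ⟨j⟩
      omega

end Matrix

/-! ### Forms that become hyperbolic over a quadratic extension -/

theorem exists_quadratic_extension {F : Type u} [Field F] {δ : F} (hδ : ¬ IsSquare δ) :
    ∃ (L : Type u) (_ : Field L) (_ : Algebra F L) (ω : L), ω * ω = algebraMap F L δ ∧
      (∀ a : L, ∃ x y : F, a = algebraMap F L x + y • ω) ∧
      ∀ x y : F, algebraMap F L x + y • ω = 0 → x = 0 ∧ y = 0 := by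
  have : Fact (∀ r : F, r ^ 2 ≠ δ + 0 * r) := ⟨fun r h => hδ ⟨r, by
    rw [← pow_two, h]; ring⟩⟩
  refine ⟨QuadraticAlgebra F δ 0, inferInstance, inferInstance, QuadraticAlgebra.omega, ?_, ?_, ?_⟩
  · rw [QuadraticAlgebra.omega_mul_omega_eq_algebraMap, map_zero, zero_mul, add_zero]
  · intro a
    exact ⟨a.re, a.im, by rw [← QuadraticAlgebra.mk_eq_add_smul_omega]⟩
  · intro x y h
    rw [← QuadraticAlgebra.mk_eq_add_smul_omega] at h
    exact ⟨congrArg QuadraticAlgebra.re h, congrArg QuadraticAlgebra.im h⟩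

namespace RegularForm

open QuadraticMap

variable {F : Type u} [Field F] [Invertible (2 : F)]

/-- If `1, ω` is a basis of `L` over `F` and `ω² = δ`, an anisotropic form that becomes isotropic
over `L` contains a multiple of `⟨1, -δ⟩`. -/
theorem exists_eq_mul_add_of_isotropic {L : Type u} [Field L] [Invertible (2 : L)] [Algebra F L]
    (δ : Fˣ) (ω : L) (hω : ω * ω = algebraMap F L δ)
    (hspan : ∀ a : L, ∃ x y : F, a = algebraMap F L x + y • ω)
    (hind : ∀ x y : F, algebraMap F L x + y • ω = 0 → x = 0 ∧ y = 0)
    (q : RegularForm F) (hq : q.form.Anisotropic) (hqL : ¬ (q.baseChange L).form.Anisotropic) :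
    ∃ (a : Fˣ) (r : RegularForm F), FormClass.mk q =
      (1 + FormClass.mk (unary (-δ))) * FormClass.mk (unary a) + FormClass.mk r := by
  obtain ⟨z, hz0, hz⟩ := (not_anisotropic_iff_exists _).mp hqL
  have hdec : ∀ z : L ⊗[F] q.carrier, ∃ u v : q.carrier,
      z = (1 : L) ⊗ₜ[F] u + ω ⊗ₜ[F] v := by
    intro z
    induction z with
    | zero => exact ⟨0, 0, by simp⟩
    | tmul a m =>
      obtain ⟨x, y, rfl⟩ := hspan a
      refine ⟨x • m, y • m, ?_⟩
      rw [← TensorProduct.smul_tmul, ← TensorProduct.smul_tmul, ← TensorProduct.add_tmul,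
        Algebra.algebraMap_eq_smul_one]
    | add x y hx hy =>
      obtain ⟨u, v, rfl⟩ := hx
      obtain ⟨u', v', rfl⟩ := hy
      exact ⟨u + u', v + v', by rw [TensorProduct.tmul_add, TensorProduct.tmul_add]; abel⟩
  obtain ⟨u, v, rfl⟩ := hdec z
  change q.form.baseChange L _ = 0 at hz
  rw [map_add_associated, QuadraticForm.associated_baseChange, QuadraticForm.baseChange_tmul,
    QuadraticForm.baseChange_tmul, LinearMap.BilinForm.baseChange_tmul, hω] at hz
  obtain ⟨hre, him⟩ := hind (q.form u + δ * q.form v) (2 * associated (R := F) q.form u v) (by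
    rw [← hz]
    simp only [Algebra.smul_def, map_add, map_mul, map_ofNat]
    ring)
  have hv : q.form v ≠ 0 := by
    intro hv
    have hu : q.form u = 0 := by simpa [hv] using hre
    rw [hq _ hv, hq _ hu] at hz0
    exact hz0 (by rw [TensorProduct.tmul_zero, TensorProduct.tmul_zero, add_zero]; rfl)
  obtain ⟨p, hp, hp'⟩ := exists_split q (Units.mk0 _ hv) v rfl
  obtain ⟨u', hu'⟩ := hp' u (by
    rw [associated_comm]
    simpa [Invertible.ne_zero (2 : F)] using him)
  obtain ⟨r, hr, -⟩ := exists_split p (-δ * Units.mk0 _ hv) u' (by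
    rw [hu']
    simp
    linear_combination hre)
  refine ⟨Units.mk0 _ hv, r, ?_⟩
  rw [hp, hr, ← FormClass.unary_mul_unary]
  ring

/-- If `1, ω` is a basis of `L` over `F` and `ω² = δ`, an anisotropic form that becomes hyperbolic
over `L` is a multiple of `⟨1, -δ⟩`. -/
theorem exists_eq_mul_of_map_eq_zero {L : Type u} [Field L] [Invertible (2 : L)] [Algebra F L]
    (δ : Fˣ) (ω : L) (hω : ω * ω = algebraMap F L δ)
    (hspan : ∀ a : L, ∃ x y : F, a = algebraMap F L x + y • ω)
    (hind : ∀ x y : F, algebraMap F L x + y • ω = 0 → x = 0 ∧ y = 0)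
    (q : RegularForm F) (hq : q.form.Anisotropic)
    (h0 : WittRing.map L (WittRing.mk q) = 0) :
    ∃ τ : FormClass F, FormClass.mk q = (1 + FormClass.mk (unary (-δ))) * τ := by
  induction hd : q.dim using Nat.strong_induction_on generalizing q with
  | _ n ih =>
    by_cases hn : q.dim = 0
    · exact ⟨0, by rw [mk_eq_zero_of_dim hn, mul_zero]⟩
    have hiso : ¬ (q.baseChange L).form.Anisotropic := fun h =>
      hn (by simpa using WittRing.dim_eq_zero_of_anisotropic h0 h)
    obtain ⟨a, r, h⟩ := exists_eq_mul_add_of_isotropic δ ω hω hspan hind q hq hiso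
    have hdim := congrArg FormClass.dim h
    rw [add_mul, one_mul, FormClass.unary_mul_unary] at hdim
    simp only [map_add, FormClass.dim_mk, dim_unary] at hdim
    have h0r : WittRing.map L (WittRing.mk r) = 0 := by
      have hδ : WittRing.map L (WittRing.mk (unary (-δ))) = -1 := by
        have e : FormClass.mk (unary (FormClass.unitMap L (-δ))) =
            FormClass.mk (unary (-1 : Lˣ)) := by
          have hω0 : ω ≠ 0 := by
            rintro rfl
            exact δ.ne_zero ((map_eq_zero (algebraMap F L)).mp (by rw [← hω, mul_zero]))
          have h1 : FormClass.unitMap L (-δ) = -1 * (Units.mk0 ω hω0 * Units.mk0 ω hω0) := by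
            ext
            simp [hω]
          rw [h1, ← FormClass.unary_mul_unary, FormClass.unary_mul_self, mul_one]
        rw [WittRing.map_unary]
        change WittRing.ofClass _ = _
        rw [e]
        change WittRing.mk _ = _
        rw [← WittRing.neg_unary, WittRing.mk_one]
      have hW := congrArg (fun x => WittRing.map L (WittRing.ofClass x)) h
      simp only [map_add, map_mul, map_one] at hW
      change WittRing.map L (WittRing.mk q) = (1 + WittRing.map L (WittRing.mk (unary (-δ)))) *
        WittRing.map L (WittRing.mk (unary a)) + WittRing.map L (WittRing.mk r) at hW
      rw [hδ, h0, add_neg_cancel, zero_mul, zero_add] at hW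
      exact hW.symm
    have hr : r.form.Anisotropic := by
      obtain ⟨s, hs⟩ := FormClass.exists_rep
        ((1 + FormClass.mk (unary (-δ))) * FormClass.mk (unary a))
      rw [hs] at h
      exact (anisotropic_of_mk_eq_add h hq).2
    obtain ⟨τ, hτ⟩ := ih _ (by omega) r hr h0r rfl
    exact ⟨FormClass.mk (unary a) + τ, by rw [h, hτ, mul_add]⟩

/-- If `1, ω` is a basis of `L` over `F` and `ω² = δ`, then `-δ` is a similarity factor of every
anisotropic form that becomes hyperbolic over `L`. -/
theorem exists_apply_eq_neg_mul {L : Type u} [Field L] [Invertible (2 : L)] [Algebra F L]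
    (δ : Fˣ) (ω : L) (hω : ω * ω = algebraMap F L δ)
    (hspan : ∀ a : L, ∃ x y : F, a = algebraMap F L x + y • ω)
    (hind : ∀ x y : F, algebraMap F L x + y • ω = 0 → x = 0 ∧ y = 0)
    (q : RegularForm F) (hq : q.form.Anisotropic)
    (h0 : WittRing.map L (WittRing.mk q) = 0) (v : q.carrier) :
    ∃ w, q.form w = -δ * q.form v := by
  obtain ⟨τ, hτ⟩ := exists_eq_mul_of_map_eq_zero δ ω hω hspan hind q hq h0
  have h : FormClass.mk (q.scale (-δ)) = FormClass.mk q := by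
    rw [mk_scale, hτ, ← mul_assoc, mul_add, mul_one, FormClass.unary_mul_unary,
      FormClass.unary_mul_self, add_comm]
  exact (FormClass.mk_eq_iff.mp h).exists_apply_eq v

end RegularForm

/-! ### The Hauptsatz of Arason and Pfister -/

namespace RegularForm

open QuadraticMap

/-- A form over `k` has diagonal coordinates, which also describe it over every extension. -/
theorem exists_diagonal_matrix {k : Type u} [Field k] [Invertible (2 : k)] (q : RegularForm k) :
    ∃ w : Fin q.dim → kˣ,
      (∃ e : (Fin q.dim → k) ≃ₗ[k] q.carrier, ∀ x, q.form (e x) =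
        (Matrix.diagonal fun i => (w i : k)).bilin x x) ∧
      ∀ (L : Type u) [Field L] [Invertible (2 : L)] [Algebra k L],
      ∃ e : (Fin q.dim → L) ≃ₗ[L] (q.baseChange L).carrier, ∀ x, (q.baseChange L).form (e x) =
        ((Matrix.diagonal fun i => (w i : k)).map (algebraMap k L)).bilin x x := by
  have key : ∀ (n : ℕ) (L : Type u) [Field L] [Invertible (2 : L)] (w : Fin n → Lˣ)
      (p : RegularForm L), FormClass.mk p = ∑ i, FormClass.mk (unary (w i)) →
      ∃ e : (Fin n → L) ≃ₗ[L] p.carrier, ∀ x, p.form (e x) =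
        (Matrix.diagonal fun i => (w i : L)).bilin x x := by
    intro n L _ _ w p h
    obtain ⟨f⟩ := equivalent_of_mk_eq_sum_unary h
    refine ⟨f.toLinearEquiv, fun x => ?_⟩
    change p.form (f x) = _
    rw [f.map_app, QuadraticMap.weightedSumSquares_apply, Matrix.bilin, dotProduct]
    refine Finset.sum_congr rfl fun i _ => ?_
    rw [Matrix.mulVec_diagonal, Units.smul_def, smul_eq_mul]
    ring
  obtain ⟨w, hw⟩ := FormClass.exists_eq_sum_unary q
  refine ⟨w, key _ k w q hw, fun L _ _ _ => ?_⟩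
  have h := congrArg (FormClass.map L) hw
  rw [map_sum, FormClass.map_mk] at h
  simp only [FormClass.map_unary] at h
  rw [Matrix.diagonal_map (map_zero _)]
  have hcoe : (fun i => algebraMap k L (w i)) =
      fun i => ((FormClass.unitMap L (w i) : Lˣ) : L) := rfl
  rw [hcoe]
  exact key q.dim L (fun i => FormClass.unitMap L (w i)) (q.baseChange L) h

/-- An extension containing `√δ`, where `-δ = ∑ i, (w (i + 1) / w 0) * x i ^ 2`, kills every
Pfister form with the diagonalization `w`. -/
theorem map_pfister_eq_zero_of_sqrt {k F L : Type u} [Field k] [Field F] [Field L]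
    [Invertible (2 : k)] [Invertible (2 : L)] [Algebra k F] [Algebra F L] [Algebra k L]
    [IsScalarTower k F L] {l : List kˣ} {N : ℕ} {w : Fin (N + 1) → kˣ}
    (hw : FormClass.mk (pfister l) = ∑ i, FormClass.mk (unary (w i))) {x : Fin N → F}
    (hx : x ≠ 0) {δ : F}
    (hδ : algebraMap k F (w 0) * δ + ∑ i, algebraMap k F (w (Fin.succ i)) * x i ^ 2 = 0) (y : L)
    (hy : y * y = algebraMap F L δ) : WittRing.map L (WittRing.mk (pfister l)) = 0 := by
  refine map_witt_pfister_eq_zero L hw (Fin.cons y (algebraMap F L ∘ x)) ?_ ?_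
  · intro h
    refine hx (funext fun i => ?_)
    have := congrFun h i.succ
    simpa using this
  · rw [Fin.sum_univ_succ]
    simp only [Fin.cons_zero, Fin.cons_succ, Function.comp_apply]
    rw [pow_two, hy, ← map_zero (algebraMap F L), ← hδ]
    simp only [map_add, map_mul, map_sum, map_pow, IsScalarTower.algebraMap_apply k F L]

/-- A replacement for the function field of a Pfister form `π`: a field `L` over which `π` becomes
trivial, and over which the anisotropic form `q` either stays anisotropic, or becomes hyperbolic
only if the pure part of `π`, of dimension `2 ^ n - 1`, fits into `q`. It is `F` or `F(√δ)` for the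
field `F` of rational functions in `2 ^ n - 1` variables and the element `δ` of `F` for which `π`
vanishes at `(√δ, x)`. -/
theorem exists_extension_pfister {k : Type u} [Field k] [Invertible (2 : k)] (q : RegularForm k)
    (hq : q.form.Anisotropic) (hq0 : q.dim ≠ 0) (l : List kˣ) (hl : l ≠ []) :
    ∃ (L : Type u) (_ : Field L) (_ : Invertible (2 : L)) (_ : Algebra k L),
      WittRing.map L (WittRing.mk (pfister l)) = 0 ∧
      ((q.baseChange L).form.Anisotropic ∨
        (WittRing.map L (WittRing.mk q) = 0 → 2 ^ l.length ≤ q.dim + 1)) := by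
  have h2 : (2 : k) ≠ 0 := Invertible.ne_zero 2
  obtain ⟨N, hN⟩ : ∃ N, 2 ^ l.length = N + 1 := ⟨2 ^ l.length - 1, by
    have := Nat.two_pow_pos l.length
    omega⟩
  have hN0 : N ≠ 0 := by
    have : l.length ≠ 0 := by simpa using hl
    have := Nat.one_lt_two_pow this
    omega
  obtain ⟨w, hw⟩ : ∃ w : Fin (N + 1) → kˣ,
      FormClass.mk (pfister l) = ∑ i, FormClass.mk (unary (w i)) := by
    rw [← hN, ← dim_pfister]
    exact FormClass.exists_eq_sum_unary _
  obtain ⟨F, _, _, x, hx, hani, hrep⟩ := Matrix.exists_generic_extension k h2 N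
  have hF2 : (2 : F) ≠ 0 := by
    rw [← map_ofNat (algebraMap k F) 2]; simp [h2]
  let : Invertible (2 : F) := invertibleOfNonzero hF2
  obtain ⟨c, ⟨e, he⟩, hc⟩ := exists_diagonal_matrix q
  obtain ⟨eF, heF⟩ := hc F
  set A := Matrix.diagonal fun i => (c i : k) with hA
  have hAani : A.Aniso := fun x h => e.map_eq_zero_iff.mp (hq _ ((he x).trans h))
  have hqF : (q.baseChange F).form.Anisotropic := by
    intro z hz
    obtain ⟨y, rfl⟩ := eF.surjective z
    rw [hani A hAani y ((heF y).symm.trans hz), map_zero]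
  have hxne : x ≠ 0 := fun h => hx ⟨0, Nat.pos_of_ne_zero hN0⟩ (congrFun h _)
  have hw0 : algebraMap k F (w 0) ≠ 0 := by simp
  obtain ⟨δ, hδ⟩ : ∃ δ : F,
      δ = -(∑ i, algebraMap k F (w (Fin.succ i)) * x i ^ 2) / algebraMap k F (w 0) := ⟨_, rfl⟩
  have hδ' : algebraMap k F (w 0) * δ + ∑ i, algebraMap k F (w (Fin.succ i)) * x i ^ 2 = 0 := by
    rw [hδ, mul_div_cancel₀ _ hw0, neg_add_cancel]
  by_cases hsq : IsSquare δ
  · obtain ⟨y, hy⟩ := hsq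
    exact ⟨F, inferInstance, inferInstance, inferInstance,
      map_pfister_eq_zero_of_sqrt (F := F) hw hxne hδ' y hy.symm, Or.inl hqF⟩
  · have hδ0 : δ ≠ 0 := fun h => hsq (h ▸ IsSquare.zero)
    obtain ⟨L, _, _, ω, hω, hspan, hind⟩ := exists_quadratic_extension hsq
    let : Invertible (2 : L) := invertibleOfNonzero (by
      rw [← map_ofNat (algebraMap F L) 2]; simp [hF2])
    let : Algebra k L := ((algebraMap F L).comp (algebraMap k F)).toAlgebra
    have : IsScalarTower k F L := IsScalarTower.of_algebraMap_eq' rfl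
    refine ⟨L, inferInstance, inferInstance, inferInstance,
      map_pfister_eq_zero_of_sqrt hw hxne hδ' ω hω, Or.inr fun h0 => ?_⟩
    have h0F : WittRing.map L (WittRing.mk (q.baseChange F)) = 0 := by
      rw [← WittRing.map_mk, WittRing.map_map, h0]
    -- `q` takes a non-zero value `b` over `k`, hence the value `-δ b` over `F`.
    obtain ⟨v, hv⟩ : ∃ v : q.carrier, v ≠ 0 := by
      have : Nontrivial q.carrier := Module.nontrivial_of_finrank_pos (R := k)
        (Nat.pos_of_ne_zero hq0)
      exact exists_ne 0
    have hb : q.form v ≠ 0 := fun h => hv (hq _ h)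
    obtain ⟨z, hz⟩ := exists_apply_eq_neg_mul (Units.mk0 δ hδ0) ω hω hspan hind
      (q.baseChange F) hqF h0F ((1 : F) ⊗ₜ[k] v)
    obtain ⟨y, rfl⟩ := eF.surjective z
    have hval : (q.baseChange F).form ((1 : F) ⊗ₜ[k] v) = algebraMap k F (q.form v) := by
      change q.form.baseChange F _ = _
      rw [QuadraticForm.baseChange_tmul, mul_one, Algebra.algebraMap_eq_smul_one]
    have := hrep A (Matrix.isSymm_diagonal _) hAani
      (fun i => q.form v * w i.succ / w 0) y (fun i => by simp [hb]) (by
        rw [← heF, hz, hval, Units.val_mk0, hδ, neg_div, neg_neg, Finset.sum_div, Finset.sum_mul]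
        refine Finset.sum_congr rfl fun i _ => ?_
        rw [map_div₀, map_mul]
        ring)
    rw [Fintype.card_fin] at this
    omega

end RegularForm

namespace WittRing

open RegularForm

/-- The Hauptsatz for a form that is Witt equivalent to a sum of `s` scalar multiples of `n`-fold
Pfister forms, by induction on `s` for all fields at once. -/
theorem IsPfisterSum.two_pow_le_dim {n : ℕ} (hn : n ≠ 0) (s : ℕ) :
    ∀ (k : Type u) [Field k] [Invertible (2 : k)] (q : RegularForm k), q.form.Anisotropic →
      Even q.dim → IsPfisterSum n s (mk q) → q.dim = 0 ∨ 2 ^ n ≤ q.dim := by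
  induction s with
  | zero =>
    intro k _ _ q hq _ h
    left
    generalize hx : mk q = x at h
    cases h
    exact dim_eq_zero_of_anisotropic hx hq
  | succ s ih =>
    intro k _ _ q hq heven h
    by_cases hq0 : q.dim = 0
    · exact Or.inl hq0
    right
    generalize hx : mk q = x at h
    cases h with
    | @add _ x a l hl h =>
      obtain ⟨L, _, _, _, hl0, hL⟩ := exists_extension_pfister q hq hq0 l (by
        rintro rfl; exact hn hl.symm)
      have hmap : WittRing.map L (mk q) = WittRing.map L x := by
        rw [hx, map_add, map_mul, hl0, mul_zero, zero_add]
      have hsum := h.map L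
      rw [← hmap] at hsum
      obtain ⟨p, hp, hpani, hple⟩ := WittRing.exists_anisotropic (q.baseChange L)
      rw [dim_baseChange] at hple
      have hpeven : Even p.dim := even_dim_of_mk_eq hp.symm (by rwa [dim_baseChange])
      have := ih L p hpani hpeven (by rw [hp]; exact hsum)
      rcases this with hp0 | hp2
      · have hz : mk (q.baseChange L) = 0 := by
          rw [← hp]
          change ofClass _ = 0
          rw [mk_eq_zero_of_dim hp0, map_zero]
        rcases hL with hani | hL
        · have := dim_eq_zero_of_anisotropic hz hani
          rw [dim_baseChange] at this
          exact absurd this hq0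
        · have := hL hz
          rw [hl] at this
          have h2n : Even (2 ^ n) := (Nat.even_pow' hn).mpr even_two
          rw [Nat.even_iff] at heven h2n
          omega
      · omega

/-- The Hauptsatz of Arason and Pfister: a form of dimension less than `2 ^ n` whose Witt class
lies in the `n`-th power of the fundamental ideal is trivial in the Witt ring. -/
theorem mk_eq_zero_of_mem_pow {k : Type u} [Field k] [Invertible (2 : k)] {n : ℕ} (hn : n ≠ 0)
    {q : RegularForm k} (h : mk q ∈ fundamentalIdeal k ^ n) (hd : q.dim < 2 ^ n) : mk q = 0 := by
  obtain ⟨p, hp, hpani, hple⟩ := WittRing.exists_anisotropic q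
  rw [← hp] at h ⊢
  obtain ⟨s, hs⟩ := exists_isPfisterSum n h
  have heven : Even p.dim := even_dim_of_mem (Ideal.pow_le_self hn h)
  rcases hs.two_pow_le_dim hn s k p hpani heven with h0 | h0
  · change ofClass _ = 0
    rw [mk_eq_zero_of_dim h0, map_zero]
  · omega

end WittRing

/-! ### The Witt index -/

section WittIndex

open RegularForm

theorem exists_equivalent_hyperbolicForm {k : Type u} [Field k] [Invertible (2 : k)] (m : ℕ) :
    ∃ p : RegularForm k, FormClass.mk p = m • FormClass.hyp k ∧
      (hyperbolicForm k m).Equivalent p.form := by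
  have hH : (QuadraticMap.prod QuadraticMap.sq (-QuadraticMap.sq) : QuadraticForm k (k × k)) =
      (unaryForm 1).prod (unaryForm (-1)) := by
    ext x
    simp [unaryForm]
  induction m with
  | zero =>
    refine ⟨RegularForm.zero k, by simp [FormClass.mk_zero],
      ⟨{ (0 : (Fin 0 → k × k) ≃ₗ[k] PUnit.{u + 1}) with map_app' := fun x => ?_ }⟩⟩
    rw [Subsingleton.elim x 0]
    exact (QuadraticMap.map_zero _).trans (QuadraticMap.map_zero _).symm
  | succ m ih =>
    obtain ⟨p, hp, e⟩ := ih
    refine ⟨((unary 1).orthSum (unary (-1))).orthSum p, ?_, ?_⟩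
    · rw [← FormClass.mk_add, hp, add_smul, one_smul, add_comm]
      rfl
    · let c := (Fin.consLinearEquiv k fun _ : Fin (m + 1) => k × k).symm
      have hc : ∀ x, (((unaryForm 1).prod (unaryForm (-1))).prod (hyperbolicForm k m)) (c x) =
          hyperbolicForm k (m + 1) x := by
        intro x
        rw [← hH, hyperbolicForm, QuadraticMap.prod_apply, hyperbolicForm,
          QuadraticMap.pi_apply, QuadraticMap.pi_apply, Fin.sum_univ_succ]
        rfl
      have h1 : (hyperbolicForm k (m + 1)).Equivalent
          (((unaryForm 1).prod (unaryForm (-1))).prod (hyperbolicForm k m)) :=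
        ⟨{ c with map_app' := hc }⟩
      exact h1.trans (QuadraticMap.Equivalent.prod (.refl _) e)

theorem exists_equivalent_fin {k : Type u} [Field k] (q : RegularForm k) :
    ∃ (d : ℕ) (ψ : QuadraticForm k (Fin d → k)), q.form.Equivalent ψ := by
  let f := (Module.finBasis k q.carrier).equivFun
  refine ⟨_, q.form.comp f.symm.toLinearMap, ⟨{ f with map_app' := fun x => ?_ }⟩⟩
  exact congrArg q.form (f.symm_apply_apply x)

theorem finrank_eq_of_equivalent_hyperbolicForm {K M : Type*} [Field K] [AddCommGroup M]
    [Module K M] {Q : QuadraticForm K M} {m d : ℕ} {ψ : QuadraticForm K (Fin d → K)}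
    (h : Q.Equivalent ((hyperbolicForm K m).prod ψ)) : Module.finrank K M = 2 * m + d := by
  obtain ⟨e⟩ := h
  rw [e.toLinearEquiv.finrank_eq]
  simp [Module.finrank_prod, Module.finrank_pi_fintype, mul_comm]

theorem bddAbove_wittIndex {K M : Type*} [Field K] [AddCommGroup M] [Module K M]
    (Q : QuadraticForm K M) : BddAbove {m : ℕ | ∃ (d : ℕ) (ψ : QuadraticForm K (Fin d → K)),
      Q.Equivalent ((hyperbolicForm K m).prod ψ)} := by
  refine ⟨Module.finrank K M, ?_⟩
  rintro m ⟨d, ψ, h⟩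
  have := finrank_eq_of_equivalent_hyperbolicForm h
  omega

variable {k : Type u} [Field k] [Invertible (2 : k)]

theorem le_wittIndex {p q : RegularForm k} {m : ℕ}
    (h : FormClass.mk q = m • FormClass.hyp k + FormClass.mk p) : m ≤ wittIndex q.form := by
  obtain ⟨s, hs, e⟩ := exists_equivalent_hyperbolicForm (k := k) m
  rw [← hs] at h
  have e' : q.form.Equivalent (s.form.prod p.form) := FormClass.mk_eq_iff.mp h
  obtain ⟨d, ψ, eψ⟩ := exists_equivalent_fin p
  exact le_csSup (bddAbove_wittIndex q.form) ⟨d, ψ,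
    e'.trans (QuadraticMap.Equivalent.prod e.symm eψ)⟩

/-- A regular form splits off as many hyperbolic planes as its Witt index says. -/
theorem exists_eq_wittIndex_nsmul_hyp_add (q : RegularForm k) : ∃ p : RegularForm k,
    FormClass.mk q = wittIndex q.form • FormClass.hyp k + FormClass.mk p := by
  have hne : {m : ℕ | ∃ (d : ℕ) (ψ : QuadraticForm k (Fin d → k)),
      q.form.Equivalent ((hyperbolicForm k m).prod ψ)}.Nonempty := by
    obtain ⟨s, hs, e⟩ := exists_equivalent_hyperbolicForm (k := k) 0
    obtain ⟨d, ψ, eψ⟩ := exists_equivalent_fin q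
    have h : FormClass.mk q = FormClass.mk (s.orthSum q) := by
      rw [← FormClass.mk_add, hs, zero_smul, zero_add]
    have h' : q.form.Equivalent (s.form.prod q.form) := FormClass.mk_eq_iff.mp h
    exact ⟨0, d, ψ, h'.trans (QuadraticMap.Equivalent.prod e.symm eψ)⟩
  obtain ⟨d, ψ, h⟩ := Nat.sSup_mem hne (bddAbove_wittIndex q.form)
  change q.form.Equivalent ((hyperbolicForm k (wittIndex q.form)).prod ψ) at h
  obtain ⟨s, hs, e⟩ := exists_equivalent_hyperbolicForm (k := k) (wittIndex q.form)
  have hreg := regular_right_of_prod (regular_of_equivalent h q.regular)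
  refine ⟨⟨Fin d → k, ψ, hreg⟩, ?_⟩
  rw [← hs, FormClass.mk_add]
  exact FormClass.mk_eq_iff.mpr (h.trans (QuadraticMap.Equivalent.prod e (.refl _)))

end WittIndex

end

theorem mainTheorem2 {k : Type u} [Field k] [Invertible (2 : k)]
    (V : Set (Valuation k ℤᵐ⁰)) (hV : V.Nonempty) (hdisc : ∀ v ∈ V, v.IsRankOneDiscrete)
    (hiso : LocalGlobalIsometry V)
    (n : ℕ) (hn : 1 ≤ n) (r : ℕ) (q : RegularForm k) (hq : q.IsINeighbor n r) :
    Even (q.dim + r) ∧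
      q.SatisfiesLGP V (((q.dim : ℤ) + r - 2 ^ n) / 2 + 1) (((q.dim : ℤ) - r) / 2) := by
  obtain ⟨hrq, σ, hσ, hmem⟩ := hq
  have hn0 : n ≠ 0 := by omega
  have hdim : (q.orthSum σ).dim = q.dim + r := by rw [RegularForm.dim_orthSum, hσ]
  have heven : Even (q.dim + r) := by
    rw [← hdim]
    exact WittRing.even_dim_of_mem (Ideal.pow_le_self hn0 hmem)
  refine ⟨heven, fun hloc => ?_⟩
  obtain ⟨e, he⟩ := heven
  obtain ⟨h, hh, -⟩ := exists_equivalent_hyperbolicForm (k := k) e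
  have hhdim : h.dim = q.dim + r := by
    have := congrArg FormClass.dim hh
    rw [FormClass.dim_nsmul_hyp, FormClass.dim_mk] at this
    omega
  have hlocal : ∀ v ∈ V, ((q.orthSum σ).atPlace v).Equivalent (h.atPlace v) := by
    intro v hv
    let K := v.Completion
    have hK2 : (2 : K) ≠ 0 := by
      rw [← map_ofNat (algebraMap k K) 2, Ne, map_eq_zero]
      exact Invertible.ne_zero 2
    let : Invertible (2 : K) := invertibleOfNonzero hK2
    obtain ⟨p, hp⟩ := exists_eq_wittIndex_nsmul_hyp_add (q.baseChange K)
    have hi : ((q.dim : ℤ) + r - 2 ^ n) / 2 + 1 ≤ (wittIndex (q.baseChange K).form : ℤ) :=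
      hloc v hv
    have hpd := congrArg FormClass.dim hp
    rw [map_add, FormClass.dim_nsmul_hyp, FormClass.dim_mk, FormClass.dim_mk,
      RegularForm.dim_baseChange] at hpd
    have hW : WittRing.mk ((q.orthSum σ).baseChange K) =
        WittRing.mk (p.orthSum (σ.baseChange K)) := by
      rw [← WittRing.map_mk, ← WittRing.mk_add, map_add, ← WittRing.mk_add, WittRing.map_mk,
        WittRing.map_mk]
      congr 1
      change WittRing.ofClass _ = WittRing.ofClass _
      rw [hp, map_add, map_nsmul, WittRing.ofClass_hyp, smul_zero, zero_add]
    have hmemK : WittRing.mk ((q.orthSum σ).baseChange K) ∈ fundamentalIdeal K ^ n := by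
      have hle : (fundamentalIdeal k).map (WittRing.map K) ≤ fundamentalIdeal K := by
        rw [Ideal.map_le_iff_le_comap]
        rintro _ ⟨s, hs, rfl⟩
        exact ⟨s.baseChange K, by rwa [RegularForm.dim_baseChange], rfl⟩
      have := Ideal.mem_map_of_mem (WittRing.map K) hmem
      rw [Ideal.map_pow] at this
      exact Ideal.pow_right_mono hle n this
    have h0 : WittRing.mk ((q.orthSum σ).baseChange K) = 0 := by
      rw [hW] at hmemK ⊢
      refine WittRing.mk_eq_zero_of_mem_pow hn0 hmemK ?_
      rw [RegularForm.dim_orthSum, RegularForm.dim_baseChange, hσ]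
      have hpow : (2 : ℤ) ^ n = ((2 ^ n : ℕ) : ℤ) := by push_cast; rfl
      rw [hpow] at hi
      have h2n : Even (2 ^ n) := (Nat.even_pow' hn0).mpr even_two
      rw [Nat.even_iff] at h2n
      omega
    have hh0 : WittRing.mk (h.baseChange K) = 0 := by
      rw [← WittRing.map_mk]
      have : WittRing.mk h = 0 := by
        change WittRing.ofClass _ = 0
        rw [hh, map_nsmul, WittRing.ofClass_hyp, smul_zero]
      rw [this, map_zero]
    exact FormClass.mk_eq_iff.mp (WittRing.mk_eq_of_dim_eq (h0.trans hh0.symm) (by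
      rw [RegularForm.dim_baseChange, RegularForm.dim_baseChange, hhdim, hdim]))
  have hglobal : FormClass.mk (q.orthSum σ) = e • FormClass.hyp k :=
    (FormClass.mk_eq_iff.mpr (hiso _ _ hlocal)).trans hh
  -- Cancellation of `σ ⊥ -σ = rℍ` from `q ⊥ σ ⊥ -σ = eℍ ⊥ -σ`.
  have hcancel : FormClass.mk q = (e - r) • FormClass.hyp k + FormClass.mk (σ.scale (-1)) := by
    have hσσ : FormClass.mk σ + FormClass.mk (σ.scale (-1)) = r • FormClass.hyp k := by
      rw [RegularForm.mk_scale, ← hσ, ← FormClass.mul_hyp, FormClass.hyp_eq]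
      ring
    refine add_right_cancel (b := r • FormClass.hyp k) ?_
    rw [add_right_comm, ← add_smul, Nat.sub_add_cancel (by omega), ← hσσ, ← add_assoc,
      FormClass.mk_add, hglobal]
  have := le_wittIndex hcancel
  omega
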